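/- **Setting.** A *sequence of instructions* is a walk $x_0=0,x_1,x_2,\dots$ in $\mathbb Z^2$ whose increments are unit steps $(\pm1,0),(0,\pm1)$; it may be random. Given $p\in[0,1]$, the *guided random walk* following it is the process with $X_0=0$ such that, independently in each step $t$ and independently of the instructions, $X_{t+1}-X_t=x_{t+1}-x_t$ with probability $1-p$, and $X_{t+1}-X_t$ is uniform on $\{(\pm1,0),(0,\pm1)\}$ with probability $p$. For $x_{\mathrm{home}}\in\mathbb Z^2$ let $T=\inf\{t\ge 0: X_t=x_{\mathrm{home}}\}\in[0,\infty]$. **The sweeping strategy** with parameters $A,B>0$ and $p_0\in(0,1)$. The first two instructions are one step east and one step west; after that the instructions consist of consecutive phases, the first of which starts at time $2$. Each phase starts and ends at the origin. For a phase starting at time $t$ let $$W=\Big\lceil \tfrac{A\sqrt t}{1-p_0}\Big\rceil,\quad H=\Big\lceil \tfrac{B\sqrt t}{1-p_0}\Big\rceil,\quad G=\Big\lceil \tfrac{1}{1-p_0}\tfrac{\sqrt t}{\ln t}\Big\rceil,\quad N=\Big\lceil \tfrac{2H}{G}\Big\rceil,\quad M=G+\lceil t^{1/3}\rceil,$$ and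 let $Z$ be uniform on $\{1,\dots,M\}$, independently for different phases. The instructions of the phase are: 1. move $W$ steps west and then $H$ steps south, to $(-W,-H)$; 2. move $Z$ steps north; 3. traverse $N$ horizontal lines at vertical distance $G$: $2W$ steps east, $G$ steps north, $2W$ steps west, $G$ steps north, and so on, ending with the $N$-th line; 4. move $M-Z$ steps north, and then return to $(0,0)$, first horizontally and then vertically. (The duration of a phase does not depend on $Z$, so the starting times of the phases are deterministic.) **Theorem.** The function $g(b)=\frac{1}{2b^2}\left(1-4e^{-b^2/4+2}\right)$ on $b>0$ has a maximizer $a=4.566\dots$, and the equation $\frac{p_0\sqrt{3-2p_0}}{(1-p_0)^2}=g(a)$ has a solution $p_0=0.01139\dots$. For the sweeping strategy with parameters $A=a\sqrt{\frac{p_0}{2}(3-2p_0)}$, $B=a\sqrt{\frac{p_0}{2}}$ and $p_0$, the following holds: for every $0\le p<p_0$ and every $x_{\mathrm{home}}\in\mathbb Z^2$, the guided random walk following this one (random) sequence of instructions, whose law depends neither on $p$ nor on $x_{\mathrm{home}}$, satisfies $\mathbb E[T]<\infty$, the expectation being over the offsets $Z$ and the errors of the agent. -/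

import Mathlib

open MeasureTheory ProbabilityTheory
open scoped ENNReal

/-! ### Guided random walks on `ℤ²` -/

/-- The four unit steps east, west, north, south. -/
def unitSteps : Finset (ℤ × ℤ) := {(1, 0), (-1, 0), (0, 1), (0, -1)}

/-- The randomness of one time step: a flag telling whether the agent makes a mistake
(probability `p`), and, independently, a uniformly random unit step. -/
noncomputable def stepNoiseLaw (p : unitInterval) : Measure (Bool × (ℤ × ℤ)) :=
  (bernoulliMeasure true false p).prod (uniformOn (unitSteps : Set (ℤ × ℤ)))

/-- The randomness of the agent: independent noise in all time steps. -/
noncomputable def noiseLaw (p : unitInterval) : Measure (ℕ → Bool × (ℤ × ℤ)) :=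
  Measure.infinitePi fun _ => stepNoiseLaw p

/-- The guided random walk following the walk of instructions `x`, driven by the noise `ω`:
in each step the agent follows the instruction, unless it makes a mistake,
in which case it performs the random unit step. -/
def guidedWalk (x : ℕ → ℤ × ℤ) (ω : ℕ → Bool × (ℤ × ℤ)) : ℕ → ℤ × ℤ
  | 0 => 0
  | t + 1 => guidedWalk x ω t + if (ω t).1 then (ω t).2 else x (t + 1) - x t

/-- The first time at which the path `X` is at `home` (`∞` if there is none). -/
noncomputable def hittingTime (X : ℕ → ℤ × ℤ) (home : ℤ × ℤ) : ℝ≥0∞ :=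
  ⨅ (t : ℕ) (_ : X t = home), (t : ℝ≥0∞)

/-! ### The sweeping strategy -/

/-- The real parameters of the sweeping strategy. -/
structure SweepParams where
  A : ℝ
  B : ℝ
  p₀ : ℝ

namespace SweepParams

variable (P : SweepParams)

/-- Half the width of the box swept in a phase that starts at time `t`. -/
noncomputable def W (t : ℕ) : ℕ := ⌈1 / (1 - P.p₀) * (P.A * √(t : ℝ))⌉₊

/-- Half the height of the box swept in a phase that starts at time `t`. -/
noncomputable def H (t : ℕ) : ℕ := ⌈1 / (1 - P.p₀) * (P.B * √(t : ℝ))⌉₊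

/-- The vertical gap between consecutive lines. -/
noncomputable def G (t : ℕ) : ℕ := ⌈1 / (1 - P.p₀) * (√(t : ℝ) / Real.log t)⌉₊

/-- The number of horizontal lines. -/
noncomputable def N (t : ℕ) : ℕ := ⌈(2 * P.H t : ℝ) / P.G t⌉₊

/-- The largest possible vertical offset. -/
noncomputable def M (t : ℕ) : ℕ := P.G t + ⌈(t : ℝ) ^ (1 / 3 : ℝ)⌉₊

end SweepParams

/-- `n` horizontal lines of length `2 * W` at vertical distance `G`, traversed alternatingly
eastwards and westwards from bottom to top; the first one goes east iff `east` is true. -/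
def sweepLines (W G : ℕ) : ℕ → Bool → List (ℤ × ℤ)
  | 0, _ => []
  | 1, east => List.replicate (2 * W) (if east then (1, 0) else (-1, 0))
  | n + 2, east => List.replicate (2 * W) (if east then (1, 0) else (-1, 0)) ++
      List.replicate G (0, 1) ++ sweepLines W G (n + 1) (!east)

namespace SweepParams

variable (P : SweepParams)

/-- The instructions of a phase that starts at time `t`, with vertical offset `z`:
go to the south-west corner `(-W, -H)`, go `z` steps north, traverse the lines,
go `M - z` steps north, and return to the origin (first horizontally, then vertically). -/
noncomputable def phase (t z : ℕ) : List (ℤ × ℤ) :=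
  List.replicate (P.W t) (-1, 0) ++ List.replicate (P.H t) (0, -1) ++
  List.replicate z (0, 1) ++
  sweepLines (P.W t) (P.G t) (P.N t) true ++
  List.replicate (P.M t - z) (0, 1) ++
  List.replicate (P.W t) (if Odd (P.N t) then (-1, 0) else (1, 0)) ++
  List.replicate ((P.N t - 1) * P.G t + P.M t - P.H t) (0, -1)

/-- The start time of the `i`-th phase; the duration of a phase does not depend on its offset. -/
noncomputable def startTime : ℕ → ℕ
  | 0 => 2
  | i + 1 => startTime i + (P.phase (startTime i) 0).length

/-- The instructions up to the start of the `i`-th phase when the offsets are `z 0, z 1, …`.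
The first phase starts at time `2`, after one step east and one step west. -/
noncomputable def instructions (z : ℕ → ℕ) : ℕ → List (ℤ × ℤ)
  | 0 => [(1, 0), (-1, 0)]
  | i + 1 => instructions z i ++ P.phase (P.startTime i) (z i)

/-- The walk `x` of instructions: `x t` is the sum of the first `t` instructions
(these are contained in the first `t` phases, every phase being nonempty). -/
noncomputable def sweepWalk (z : ℕ → ℕ) (t : ℕ) : ℤ × ℤ :=
  ((P.instructions z t).take t).sum

/-- The law of the offsets: independent, the `i`-th one being uniform on `{1, …, M}`. -/
noncomputable def offsetLaw : Measure (ℕ → ℕ) :=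
  Measure.infinitePi fun i => uniformOn (Set.Icc 1 (P.M (P.startTime i)))

/-- The joint law of the offsets of the strategy and of the independent noise of the agent. -/
noncomputable def law (p : unitInterval) : Measure ((ℕ → ℕ) × (ℕ → Bool × (ℤ × ℤ))) :=
  P.offsetLaw.prod (noiseLaw p)

/-- The expected hitting time of `home` for the guided random walk with error probability `p`
that follows the sweeping strategy. -/
noncomputable def expectedHittingTime (p : unitInterval) (home : ℤ × ℤ) : ℝ≥0∞ :=
  ∫⁻ zω, hittingTime (guidedWalk (P.sweepWalk zω.1) zω.2) home ∂(P.law p)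

end SweepParams

/-! ### All the laws above are probability measures -/

instance (p : unitInterval) : IsProbabilityMeasure (stepNoiseLaw p) := by
  have : IsProbabilityMeasure (uniformOn (unitSteps : Set (ℤ × ℤ))) :=
    isProbabilityMeasure_uniformOn unitSteps.finite_toSet ⟨(1, 0), by simp [unitSteps]⟩
  unfold stepNoiseLaw
  infer_instance

instance (p : unitInterval) : IsProbabilityMeasure (noiseLaw p) := by
  unfold noiseLaw
  infer_instance

namespace SweepParams

variable (P : SweepParams)

theorem two_le_startTime (i : ℕ) : 2 ≤ P.startTime i := by
  induction i with
  | zero => exact le_rfl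
  | succ i ih => exact ih.trans (Nat.le_add_right _ _)

theorem one_le_M {t : ℕ} (ht : 1 ≤ t) : 1 ≤ P.M t := by
  have h : 0 < ⌈(t : ℝ) ^ (1 / 3 : ℝ)⌉₊ :=
    Nat.ceil_pos.2 (Real.rpow_pos_of_pos (by exact_mod_cast ht) _)
  unfold M
  omega

instance (i : ℕ) : IsProbabilityMeasure (uniformOn (Set.Icc 1 (P.M (P.startTime i)))) :=
  isProbabilityMeasure_uniformOn (Set.finite_Icc _ _)
    ⟨1, le_rfl, P.one_le_M (le_trans (by norm_num) (P.two_le_startTime i))⟩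

instance : IsProbabilityMeasure P.offsetLaw := by
  unfold offsetLaw
  infer_instance

instance (p : unitInterval) : IsProbabilityMeasure (P.law p) := by
  unfold law
  infer_instance

end SweepParams

/-! ### The constants `a` and `p₀` -/

/-! Fix p < p₀ and consider a phase starting at time t, of duration L of order √t ln t. Suppose the
agent is then in the box |x.1| ≤ A√t, |x.2| ≤ B√t. Couple all offsets by using the same errors for
each of them. Fluctuations during a phase have order √L, which is far below t^(1/3). So, with high
probability, the northward path and the reflected path along a suitable line cross a common
rectangle, one from bottom to top and the other from left to right. They must meet
(`exists_common_point`), and a meeting point is an offset for which home is hit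
(`exists_offset_hits`). Hence the hitting probabilities of the M offsets add up to almost 1, and a
phase succeeds with probability at least (1 - ε)/M (`eventually_phaseOp_one_le`). Since G is much
larger than t^(1/3), M/G tends to 1 and L·M is asymptotically q t with q = 4AB/(1-p₀)², so inside
the box the walk is killed at rate about 1/(q t) per unit time.

It remains to control survivors outside the box. Per step, the errors contribute variance p/2·(3-2p)
horizontally and essentially p/2 vertically, because vertical instructions are a negligible part of
a phase. Measure the coordinates in units slightly above these standard deviations, so that the box
has half-widths b√t. If the surviving mass is bounded by C T^(-h), then moments of exp(α φ/√T) are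
bounded by about exp(2h + α²) C T^(-h). The exponential Markov inequality in four directions, with
the optimal α = b/2, bounds the mass outside the box by 4 exp(2h - b²/4) C T^(-h). The two bounds
propagate together as long as h q < 1 - 4 exp(2h - b²/4) (`exists_mass_le_rpow`). For h = 1 and b =
a, equality is the equation defining p₀; this is why a maximizes g. For p < p₀ the variances are
strictly smaller, so b > a and some h > 1 is allowed (`exists_survFunctional_le`).

Finally, survival probabilities of order n^(-h) with h > 1 are summable, which bounds the expected
hitting time (`expectedHittingTime_lt_top`). -/

theorem exists_maximizer_equation :
    ∃ a : ℝ, 4.566 ≤ a ∧ a < 4.567 ∧ Real.exp (a ^ 2 / 4 - 2) = 4 * (1 + a ^ 2 / 4) := by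
  have he1 := Real.exp_one_gt_d9
  have he2 := Real.exp_one_lt_d9
  have hlow : Real.exp ((4.566 : ℝ) ^ 2 / 4 - 2) < 4 * (1 + (4.566 : ℝ) ^ 2 / 4) := by
    -- The exponent is 3 + 0.212089, so decimal bounds on e and a short Taylor sum suffice.
    have h : Real.exp ((4.566 : ℝ) ^ 2 / 4 - 2) = Real.exp 1 ^ 3 * Real.exp 0.212089 := by
      rw [← Real.exp_nat_mul, ← Real.exp_add]; norm_num
    have h3 : Real.exp 1 ^ 3 ≤ (2.7182818286 : ℝ) ^ 3 := by gcongr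
    have h4 : Real.exp (0.212089 : ℝ) ≤ 1.237 := by
      have := Real.exp_bound' (x := (0.212089 : ℝ)) (by norm_num) (by norm_num) (n := 4)
        (by norm_num)
      refine this.trans ?_
      norm_num [Finset.sum_range_succ, Nat.factorial]
    rw [h]
    calc Real.exp 1 ^ 3 * Real.exp 0.212089 ≤ (2.7182818286 : ℝ) ^ 3 * 1.237 := by gcongr
      _ < _ := by norm_num
  have hhigh : 4 * (1 + (4.567 : ℝ) ^ 2 / 4) < Real.exp ((4.567 : ℝ) ^ 2 / 4 - 2) := by
    have h : Real.exp ((4.567 : ℝ) ^ 2 / 4 - 2) = Real.exp 1 ^ 3 * Real.exp 0.21437225 := by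
      rw [← Real.exp_nat_mul, ← Real.exp_add]; norm_num
    have h3 : (2.7182818283 : ℝ) ^ 3 ≤ Real.exp 1 ^ 3 := by gcongr
    have h4 : 1.239 ≤ Real.exp (0.21437225 : ℝ) := by
      have := Real.sum_le_exp_of_nonneg (x := (0.21437225 : ℝ)) (by norm_num) 5
      refine le_trans ?_ this
      norm_num [Finset.sum_range_succ, Nat.factorial]
    rw [h]
    calc _ < (2.7182818283 : ℝ) ^ 3 * 1.239 := by norm_num
      _ ≤ _ := by gcongr
  have hcont : ContinuousOn (fun a : ℝ => Real.exp (a ^ 2 / 4 - 2) - 4 * (1 + a ^ 2 / 4))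
      (Set.Icc 4.566 4.567) := by fun_prop
  obtain ⟨a, ⟨ha1, ha2⟩, ha⟩ := intermediate_value_Icc (by norm_num) hcont
    (show (0 : ℝ) ∈ Set.Icc _ _ from ⟨by linarith, by linarith⟩)
  simp only at ha
  refine ⟨a, ha1, lt_of_le_of_ne ha2 ?_, by linarith⟩
  rintro rfl
  linarith

/-- The hypothesis is the critical point equation g'(a) = 0; it eliminates the exponential from
g(a). -/
theorem maximal_value_eq {a : ℝ} (ha : 0 < a)
    (h : Real.exp (a ^ 2 / 4 - 2) = 4 * (1 + a ^ 2 / 4)) :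
    1 / (2 * a ^ 2) * (1 - 4 * Real.exp (-a ^ 2 / 4 + 2)) = 1 / (8 * (1 + a ^ 2 / 4)) := by
  have h1 : Real.exp (-a ^ 2 / 4 + 2) = (4 * (1 + a ^ 2 / 4))⁻¹ := by
    rw [← h, ← Real.exp_neg]; ring_nf
  rw [h1]
  field_simp
  ring

/-- The tangent line bound exp u ≥ 1 + u at u = (a² - b²)/4 gives 1 - 4 exp(2 - b²/4) ≤ b²/D with D
= 4(1 + a²/4). Dividing by 2b² leaves the constant 1/(2D) = g(a), so no derivative is needed. -/
theorem isMaxOn_of_equation {a : ℝ} (ha : 0 < a)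
    (h : Real.exp (a ^ 2 / 4 - 2) = 4 * (1 + a ^ 2 / 4)) :
    IsMaxOn (fun b : ℝ => 1 / (2 * b ^ 2) * (1 - 4 * Real.exp (-b ^ 2 / 4 + 2))) (Set.Ioi 0) a := by
  intro b hb
  have hb : 0 < b := hb
  simp only [Set.mem_ofPred_eq]
  rw [maximal_value_eq ha h]
  set D := 4 * (1 + a ^ 2 / 4) with hD
  have hD0 : 0 < D := by positivity
  have h1 : D⁻¹ * (1 + a ^ 2 / 4 - b ^ 2 / 4) ≤ Real.exp (-b ^ 2 / 4 + 2) := by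
    have h2 : Real.exp (-b ^ 2 / 4 + 2) = D⁻¹ * Real.exp (a ^ 2 / 4 - b ^ 2 / 4) := by
      rw [← h, ← Real.exp_neg, ← Real.exp_add]; ring_nf
    rw [h2]
    gcongr
    linarith [Real.add_one_le_exp (a ^ 2 / 4 - b ^ 2 / 4)]
  have h3 : D⁻¹ * (1 + a ^ 2 / 4 - b ^ 2 / 4) = 1 / 4 - D⁻¹ * (b ^ 2 / 4) := by
    have : D⁻¹ * D = 1 := inv_mul_cancel₀ hD0.ne'
    have h5 : 1 + a ^ 2 / 4 = D / 4 := by rw [hD]; ring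
    rw [h5, mul_sub, mul_div_assoc', this]
  have h4 : 1 - 4 * Real.exp (-b ^ 2 / 4 + 2) ≤ D⁻¹ * b ^ 2 := by linarith
  calc 1 / (2 * b ^ 2) * (1 - 4 * Real.exp (-b ^ 2 / 4 + 2))
      ≤ 1 / (2 * b ^ 2) * (D⁻¹ * b ^ 2) := by gcongr
    _ = 1 / (8 * (1 + a ^ 2 / 4)) := by rw [hD]; field_simp; ring

theorem exists_threshold {a : ℝ} (ha1 : 4.566 ≤ a) (ha2 : a < 4.567) :
    ∃ p : ℝ, 0.01139 ≤ p ∧ p < 0.01140 ∧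
      p * √(3 - 2 * p) / (1 - p) ^ 2 = 1 / (8 * (1 + a ^ 2 / 4)) := by
  have hg1 : 1 / (8 * (1 + a ^ 2 / 4)) ≤ 1 / (8 * (1 + (4.566 : ℝ) ^ 2 / 4)) := by gcongr
  have hg2 : 1 / (8 * (1 + (4.567 : ℝ) ^ 2 / 4)) ≤ 1 / (8 * (1 + a ^ 2 / 4)) := by
    have : 0 ≤ a := by linarith
    gcongr
  have h1 : √(3 - 2 * (0.01139 : ℝ)) ≤ 1.7255 := by
    rw [Real.sqrt_le_left (by norm_num)]; norm_num
  have h2 : 1.7254 ≤ √(3 - 2 * (0.01140 : ℝ)) := Real.le_sqrt_of_sq_le (by norm_num)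
  have hlow : (0.01139 : ℝ) * √(3 - 2 * 0.01139) / (1 - 0.01139) ^ 2 ≤ 1 / (8 * (1 + a ^ 2 / 4)) := by
    refine le_trans ?_ hg2
    calc _ ≤ (0.01139 : ℝ) * 1.7255 / (1 - 0.01139) ^ 2 := by gcongr
      _ ≤ _ := by norm_num
  have hhigh : 1 / (8 * (1 + a ^ 2 / 4)) < (0.01140 : ℝ) * √(3 - 2 * 0.01140) / (1 - 0.01140) ^ 2 := by
    refine lt_of_le_of_lt hg1 ?_
    calc _ < (0.01140 : ℝ) * 1.7254 / (1 - 0.01140) ^ 2 := by norm_num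
      _ ≤ _ := by gcongr
  have hcont : ContinuousOn (fun p : ℝ => p * √(3 - 2 * p) / (1 - p) ^ 2)
      (Set.Icc 0.01139 0.01140) := by
    refine ContinuousOn.div (by fun_prop) (by fun_prop) ?_
    intro p hp
    have : 1 - p ≠ 0 := by have := hp.2; intro h; norm_num at this; linarith
    positivity
  obtain ⟨p, ⟨hp1, hp2⟩, hp⟩ := intermediate_value_Icc (by norm_num) hcont
    (show 1 / (8 * (1 + a ^ 2 / 4)) ∈ Set.Icc _ _ from ⟨hlow, hhigh.le⟩)
  refine ⟨p, hp1, lt_of_le_of_ne hp2 ?_, hp⟩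
  rintro rfl
  exact hhigh.ne' hp

/-! ### Crossing paths in `ℤ²` -/

/-- The edge from `u` to `v` crosses the ray `(0, ∞) × {1 / 2}`. -/
def crossesRay (u v : ℤ × ℤ) : ZMod 2 :=
  if 0 < u.1 ∧ u.1 = v.1 ∧ ((u.2 = 0 ∧ v.2 = 1) ∨ (u.2 = 1 ∧ v.2 = 0)) then 1 else 0

/-- A closed unit square is crossed an even number of times unless it contains the end (0, 1/2) of
the ray. That point lies on the edge from (0, 0) to (0, 1), so such a square has the origin as a
vertex. The degenerate cases a = ±b are included. -/
theorem crossesRay_square {v a b : ℤ × ℤ} (ha : a ∈ unitSteps) (hb : b ∈ unitSteps)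
    (h0 : v ≠ 0) (h1 : v + a ≠ 0) (h2 : v + b ≠ 0) (h3 : v + a + b ≠ 0) :
    crossesRay v (v + a) + crossesRay (v + a) (v + a + b)
      = crossesRay v (v + b) + crossesRay (v + b) (v + a + b) := by
  obtain ⟨x, y⟩ := v
  simp only [unitSteps, Finset.mem_insert, Finset.mem_singleton] at ha hb
  rcases ha with rfl | rfl | rfl | rfl <;> rcases hb with rfl | rfl | rfl | rfl <;>
    simp only [crossesRay, ne_eq, Prod.ext_iff, Prod.fst_add, Prod.snd_add, Prod.fst_zero,
      Prod.snd_zero] at * <;>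
    split_ifs <;> first | rfl | (exfalso; omega)

/-- The parity of the number of crossings of the ray along the first `n` edges of a path. -/
def rayParity (f : ℕ → ℤ × ℤ) (n : ℕ) : ZMod 2 :=
  ∑ i ∈ Finset.range n, crossesRay (f i) (f (i + 1))

theorem rayParity_eq_zero {f : ℕ → ℤ × ℤ} {n : ℕ}
    (h : ∀ i ≤ n, (f i).1 ≤ 0 ∨ (f i).2 ≤ -1 ∨ 2 ≤ (f i).2) : rayParity f n = 0 := by
  refine Finset.sum_eq_zero fun i hi => ?_
  have := h i (Finset.mem_range.1 hi).le
  rw [crossesRay, if_neg]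
  omega

theorem rayParity_of_pos {f : ℕ → ℤ × ℤ} {n : ℕ} (hx : ∀ i ≤ n, 0 < (f i).1)
    (hs : ∀ i < n, f (i + 1) - f i ∈ unitSteps) (h0 : (f 0).2 ≤ 0) :
    rayParity f n = if 0 < (f n).2 then 1 else 0 := by
  induction n with
  | zero => simp [rayParity, h0.not_gt]
  | succ n ih =>
    rw [rayParity, Finset.sum_range_succ, ← rayParity,
      ih (fun i hi => hx i (by omega)) (fun i hi => hs i (by omega))]
    have h1 := hs n (by omega)
    have h2 := hx n (by omega)
    simp only [unitSteps, Finset.mem_insert, Finset.mem_singleton, Prod.ext_iff, Prod.fst_sub,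
      Prod.snd_sub] at h1
    rw [crossesRay]
    split_ifs <;> first | rfl | (exfalso; omega)

/-- Discrete homotopy invariance: one boundary path of the grid is pushed to the other across one
square at a time, and no square changes the parity. -/
theorem rayParity_homotopy {D : ℕ → ℕ → ℤ × ℤ} {m n : ℕ}
    (hne : ∀ i ≤ m, ∀ j ≤ n, D i j ≠ 0)
    (hsq : ∀ i < m, ∀ j < n, ∃ a ∈ unitSteps, ∃ b ∈ unitSteps, D (i + 1) j = D i j + a ∧
      D i (j + 1) = D i j + b ∧ D (i + 1) (j + 1) = D i j + a + b) :
    rayParity (fun i => D i 0) m + rayParity (D m) n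
      = rayParity (D 0) n + rayParity (fun i => D i n) m := by
  induction m with
  | zero => simp [rayParity]
  | succ m ih =>
    have ih := ih (fun i hi => hne i (by omega)) (fun i hi => hsq i (by omega))
    have key : ∀ k ≤ n, crossesRay (D m 0) (D (m + 1) 0) + rayParity (D (m + 1)) k
        = rayParity (D m) k + crossesRay (D m k) (D (m + 1) k) := by
      intro k hk
      induction k with
      | zero => simp [rayParity]
      | succ k ihk =>
        have ihk := ihk (by omega)
        simp only [rayParity] at ihk ⊢
        rw [Finset.sum_range_succ, Finset.sum_range_succ, ← add_assoc, ihk, add_assoc, add_assoc]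
        congr 1
        obtain ⟨a, ha, b, hb, e1, e2, e3⟩ := hsq m (by omega) k (by omega)
        have n1 := hne m (by omega) k (by omega)
        have n2 := hne (m + 1) (by omega) k (by omega)
        have n3 := hne m (by omega) (k + 1) (by omega)
        have n4 := hne (m + 1) (by omega) (k + 1) (by omega)
        rw [e1] at n2 ⊢
        rw [e2] at n3 ⊢
        rw [e3] at n4 ⊢
        exact crossesRay_square ha hb n1 n2 n3 n4
    have key := key n le_rfl
    have e1 : rayParity (fun i => D i 0) (m + 1)
        = rayParity (fun i => D i 0) m + crossesRay (D m 0) (D (m + 1) 0) := by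
      simp [rayParity, Finset.sum_range_succ]
    have e2 : rayParity (fun i => D i n) (m + 1)
        = rayParity (fun i => D i n) m + crossesRay (D m n) (D (m + 1) n) := by
      simp [rayParity, Finset.sum_range_succ]
    rw [e1, e2, add_assoc, key, ← add_assoc, ih, add_assoc]

/-- A nearest-neighbour path `S` and a nearest-neighbour path `Q` that cross a rectangle from bottom
to top and from left to right, respectively, have a common point. -/
theorem exists_common_point {S Q : ℕ → ℤ × ℤ} {m n : ℕ}
    (hS : ∀ i < m, S (i + 1) - S i ∈ unitSteps) (hQ : ∀ j < n, Q (j + 1) - Q j ∈ unitSteps)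
    (hleft : ∀ i ≤ m, (Q 0).1 < (S i).1) (hright : ∀ i ≤ m, (S i).1 < (Q n).1)
    (hbot : ∀ j ≤ n, (S 0).2 < (Q j).2) (htop : ∀ j ≤ n, (Q j).2 + 1 < (S m).2) :
    ∃ i ≤ m, ∃ j ≤ n, S i = Q j := by
  by_contra! hne
  have hneg : ∀ s ∈ unitSteps, -s ∈ unitSteps := by decide
  -- Without a common point the differences avoid 0, so the boundary parities balance. Along `Q 0`
  -- the difference passes from below to above on the right of the origin, which gives parity 1; the
  -- other three sides miss the ray. At the top the difference must be at least 2 since the ray has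
  -- height 1/2, hence the `+ 1` in `htop`.
  have key := rayParity_homotopy (D := fun i j => S i - Q j) (m := m) (n := n)
    (fun i hi j hj => sub_ne_zero.2 (hne i hi j hj))
    (fun i hi j hj => ⟨_, hS i hi, _, hneg _ (hQ j hj), by abel, by abel, by abel⟩)
  have hb := hbot 0 (by omega)
  have ht := htop 0 (by omega)
  rw [rayParity_of_pos (f := fun i => S i - Q 0), rayParity_eq_zero (f := fun j => S m - Q j),
    rayParity_eq_zero (f := fun j => S 0 - Q j), rayParity_eq_zero (f := fun i => S i - Q n),
    if_pos] at key
  · exact absurd key (by decide)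
  · simp only [Prod.snd_sub]; omega
  · intro i hi; have := hright i hi; left; simp only [Prod.fst_sub]; omega
  · intro j hj; have := hbot j hj; right; left; simp only [Prod.snd_sub]; omega
  · intro j hj; have := htop j hj; right; right; simp only [Prod.snd_sub]; omega
  · intro i hi; have := hleft i hi; simp only [Prod.fst_sub]; omega
  · intro i hi; simpa using hS i hi
  · simp only [Prod.snd_sub]; omega

/-! ### Expectations over the steps of an agent that is given a list of instructions -/

/-- The expectation of a function of the list of steps made by an agent with error probability `p`
who is given the instructions `l`. -/
noncomputable def stepsExp (p : ℝ) : List (ℤ × ℤ) → (List (ℤ × ℤ) → ℝ) →ₗ[ℝ] ℝ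
  | [] => LinearMap.proj []
  | d :: l => (1 - p) • (stepsExp p l ∘ₗ LinearMap.funLeft ℝ ℝ (List.cons d)) +
      (p / 4) • ∑ s ∈ unitSteps, stepsExp p l ∘ₗ LinearMap.funLeft ℝ ℝ (List.cons s)

section stepsExp

variable {p : ℝ}

@[simp]
theorem stepsExp_nil (Φ : List (ℤ × ℤ) → ℝ) : stepsExp p [] Φ = Φ [] := rfl

theorem stepsExp_cons (d : ℤ × ℤ) (l : List (ℤ × ℤ)) (Φ : List (ℤ × ℤ) → ℝ) :
    stepsExp p (d :: l) Φ = (1 - p) * stepsExp p l (fun a => Φ (d :: a)) +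
      p / 4 * ∑ s ∈ unitSteps, stepsExp p l (fun a => Φ (s :: a)) := by
  simp only [stepsExp, LinearMap.add_apply, LinearMap.smul_apply, LinearMap.sum_apply,
    LinearMap.comp_apply, smul_eq_mul]
  rfl

theorem card_unitSteps : unitSteps.card = 4 := rfl

theorem stepsExp_const (l : List (ℤ × ℤ)) (c : ℝ) : stepsExp p l (fun _ => c) = c := by
  induction l with
  | nil => rfl
  | cons d l ih =>
    rw [stepsExp_cons]
    simp only [ih, Finset.sum_const, card_unitSteps]
    simp
    ring

theorem stepsExp_append (l₁ l₂ : List (ℤ × ℤ)) (Φ : List (ℤ × ℤ) → ℝ) :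
    stepsExp p (l₁ ++ l₂) Φ
      = stepsExp p l₁ (fun a => stepsExp p l₂ (fun b => Φ (a ++ b))) := by
  induction l₁ generalizing Φ with
  | nil => rfl
  | cons d l ih => simp only [List.cons_append, stepsExp_cons, ih]

theorem stepsExp_mul_left (l : List (ℤ × ℤ)) (c : ℝ) (Φ : List (ℤ × ℤ) → ℝ) :
    stepsExp p l (fun a => c * Φ a) = c * stepsExp p l Φ :=
  (stepsExp p l).map_smul c Φ

theorem stepsExp_sub (l : List (ℤ × ℤ)) (Φ Ψ : List (ℤ × ℤ) → ℝ) :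
    stepsExp p l (fun a => Φ a - Ψ a) = stepsExp p l Φ - stepsExp p l Ψ :=
  (stepsExp p l).map_sub Φ Ψ

theorem stepsExp_add (l : List (ℤ × ℤ)) (Φ Ψ : List (ℤ × ℤ) → ℝ) :
    stepsExp p l (fun a => Φ a + Ψ a) = stepsExp p l Φ + stepsExp p l Ψ :=
  (stepsExp p l).map_add Φ Ψ

theorem stepsExp_sum {ι : Type*} (l : List (ℤ × ℤ)) (s : Finset ι)
    (Φ : ι → List (ℤ × ℤ) → ℝ) :
    stepsExp p l (fun a => ∑ i ∈ s, Φ i a) = ∑ i ∈ s, stepsExp p l (Φ i) := by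
  rw [← map_sum]
  congr 1
  ext a
  simp

/-- Monotonicity of the expectation; only lists of unit steps of the right length matter. -/
theorem stepsExp_mono_of_unitSteps (hp : p ∈ Set.Icc (0 : ℝ) 1) {l : List (ℤ × ℤ)}
    (hl : ∀ d ∈ l, d ∈ unitSteps) {Φ Ψ : List (ℤ × ℤ) → ℝ}
    (h : ∀ a, a.length = l.length → (∀ s ∈ a, s ∈ unitSteps) → Φ a ≤ Ψ a) :
    stepsExp p l Φ ≤ stepsExp p l Ψ := by
  induction l generalizing Φ Ψ with
  | nil => exact h [] rfl (by simp)
  | cons d l ih =>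
    rw [stepsExp_cons, stepsExp_cons]
    have h1 : 0 ≤ 1 - p := by linarith [hp.2]
    have h2 : 0 ≤ p / 4 := by linarith [hp.1]
    have key : ∀ s ∈ unitSteps,
        stepsExp p l (fun a => Φ (s :: a)) ≤ stepsExp p l (fun a => Ψ (s :: a)) := by
      intro s hs
      refine ih (fun d hd => hl d (List.mem_cons_of_mem _ hd)) fun a ha hu => h _ (by simp [ha]) ?_
      intro u hu'
      rcases List.mem_cons.1 hu' with rfl | h'
      exacts [hs, hu _ h']
    exact add_le_add (mul_le_mul_of_nonneg_left (key d (hl d List.mem_cons_self)) h1)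
      (mul_le_mul_of_nonneg_left (Finset.sum_le_sum key) h2)

theorem stepsExp_mono (hp : p ∈ Set.Icc (0 : ℝ) 1) (l : List (ℤ × ℤ)) {Φ Ψ : List (ℤ × ℤ) → ℝ}
    (h : ∀ a, Φ a ≤ Ψ a) : stepsExp p l Φ ≤ stepsExp p l Ψ := by
  induction l generalizing Φ Ψ with
  | nil => exact h []
  | cons d l ih =>
    rw [stepsExp_cons, stepsExp_cons]
    have h1 : 0 ≤ 1 - p := by linarith [hp.2]
    have h2 : 0 ≤ p / 4 := by linarith [hp.1]
    exact add_le_add (mul_le_mul_of_nonneg_left (ih fun a => h _) h1)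
      (mul_le_mul_of_nonneg_left (Finset.sum_le_sum fun s _ => ih fun a => h _) h2)

/-- The first steps do not depend on later instructions. This lets one long northward run realize
all offsets at once. -/
theorem stepsExp_take {l : List (ℤ × ℤ)} {n : ℕ} (hn : n ≤ l.length)
    (Φ : List (ℤ × ℤ) → ℝ) :
    stepsExp p (l.take n) Φ = stepsExp p l (fun a => Φ (a.take n)) := by
  induction l generalizing n Φ with
  | nil => simp at hn; subst hn; rfl
  | cons d l ih =>
    cases n with
    | zero => simp [stepsExp_const]
    | succ n =>
      simp only [List.length_cons, add_le_add_iff_right] at hn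
      simp only [List.take_succ_cons, stepsExp_cons, ih hn]

/-! ### Coordinates, fluctuations and exponential moments -/

/-- The properties of the two coordinates, and of their negatives, that matter for the estimates. -/
structure IsCoordinate (c : ℤ × ℤ →+ ℝ) : Prop where
  sum_eq : ∑ s ∈ unitSteps, c s = 0
  sum_sq_eq : ∑ s ∈ unitSteps, c s ^ 2 = 2
  abs_le : ∀ s ∈ unitSteps, |c s| ≤ 1

/-- The first coordinate as a real number. -/
def fstCoord : ℤ × ℤ →+ ℝ := (Int.castAddHom ℝ).comp (AddMonoidHom.fst ℤ ℤ)

/-- The second coordinate as a real number. -/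
def sndCoord : ℤ × ℤ →+ ℝ := (Int.castAddHom ℝ).comp (AddMonoidHom.snd ℤ ℤ)

@[simp] theorem fstCoord_apply (x : ℤ × ℤ) : fstCoord x = x.1 := rfl

@[simp] theorem sndCoord_apply (x : ℤ × ℤ) : sndCoord x = x.2 := rfl

theorem sum_unitSteps (f : ℤ × ℤ → ℝ) :
    ∑ s ∈ unitSteps, f s = f (1, 0) + f (-1, 0) + f (0, 1) + f (0, -1) := by
  have h : unitSteps = {(1, 0), (-1, 0), (0, 1), (0, -1)} := rfl
  rw [h, Finset.sum_insert (by decide), Finset.sum_insert (by decide),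
    Finset.sum_insert (by decide), Finset.sum_singleton]
  ring

theorem isCoordinate_fst : IsCoordinate fstCoord where
  sum_eq := by rw [sum_unitSteps]; simp
  sum_sq_eq := by rw [sum_unitSteps]; norm_num
  abs_le := by simp [unitSteps]

theorem isCoordinate_snd : IsCoordinate sndCoord where
  sum_eq := by rw [sum_unitSteps]; simp
  sum_sq_eq := by rw [sum_unitSteps]; norm_num
  abs_le := by simp [unitSteps]

theorem IsCoordinate.neg {c : ℤ × ℤ →+ ℝ} (hc : IsCoordinate c) : IsCoordinate (-c) where
  sum_eq := by simp [hc.sum_eq]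
  sum_sq_eq := by simp [hc.sum_sq_eq]
  abs_le := by simpa using hc.abs_le

variable {c : ℤ × ℤ →+ ℝ}

theorem IsCoordinate.mean_sq (hc : IsCoordinate c) (x m : ℝ) :
    ∑ s ∈ unitSteps, (x + c s - m) ^ 2 = 4 * (x - m) ^ 2 + 2 := by
  have : ∀ s, (x + c s - m) ^ 2 = (x - m) ^ 2 + 2 * (x - m) * c s + c s ^ 2 := fun s => by ring
  simp only [this, Finset.sum_add_distrib, ← Finset.mul_sum, hc.sum_eq, hc.sum_sq_eq,
    Finset.sum_const, card_unitSteps]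
  simp

open Classical in
/-- A maximal inequality for the fluctuations of a coordinate. -/
theorem stepsExp_max_deviation (hp : p ∈ Set.Icc (0 : ℝ) 1) (hc : IsCoordinate c)
    {δ : ℝ} (hδ : 0 < δ) (l : List (ℤ × ℤ)) (hl : ∀ d ∈ l, d ∈ unitSteps) (x : ℝ) :
    stepsExp p l (fun a => if ∃ k ≤ l.length,
      δ ≤ |x + c (a.take k).sum - (1 - p) * c (l.take k).sum| then 1 else 0)
      ≤ (x ^ 2 + 4 * l.length) / δ ^ 2 := by
  induction l generalizing x with
  | nil =>
    simp only [List.length_nil, Nat.le_zero_eq, exists_eq_left, stepsExp_nil, List.take_nil,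
      List.sum_nil, map_zero, mul_zero, add_zero, sub_zero, Nat.cast_zero]
    split_ifs with h
    · rw [one_le_div (by positivity)]
      nlinarith [sq_abs x, abs_nonneg x]
    · positivity
  | cons d l ih =>
    -- If δ is already reached at k = 0, the bound is at least 1. Otherwise k = 0 is impossible and
    -- the event shifts to the tail, started at the new deviation.
    by_cases hx : δ ≤ |x|
    · calc _ ≤ stepsExp p (d :: l) (fun _ => 1) :=
            stepsExp_mono hp _ fun a => by split_ifs <;> norm_num
        _ = 1 := stepsExp_const _ _
        _ ≤ x ^ 2 / δ ^ 2 := by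
            rw [one_le_div (by positivity)]
            nlinarith [sq_abs x, abs_nonneg x]
        _ ≤ _ := by gcongr; linarith [(Nat.cast_nonneg (d :: l).length : (0 : ℝ) ≤ _)]
    · rw [stepsExp_cons]
      have hl' : ∀ d ∈ l, d ∈ unitSteps := fun d hd => hl d (List.mem_cons_of_mem _ hd)
      have key : ∀ s, stepsExp p l (fun a => if ∃ k ≤ (d :: l).length,
          δ ≤ |x + c ((s :: a).take k).sum - (1 - p) * c ((d :: l).take k).sum| then 1 else 0)
          ≤ ((x + c s - (1 - p) * c d) ^ 2 + 4 * l.length) / δ ^ 2 := by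
        intro s
        refine le_trans (le_of_eq ?_) (ih hl' (x + c s - (1 - p) * c d))
        congr 1
        ext a
        congr 1
        refine propext ⟨?_, ?_⟩
        · rintro ⟨k, hk, h⟩
          cases k with
          | zero => simp at h; exact absurd h hx
          | succ k =>
            refine ⟨k, by simpa using hk, h.trans_eq ?_⟩
            simp only [List.take_succ_cons, List.sum_cons, map_add]
            congr 1; ring
        · rintro ⟨k, hk, h⟩
          refine ⟨k + 1, by simpa using hk, h.trans_eq ?_⟩
          simp only [List.take_succ_cons, List.sum_cons, map_add]
          congr 1; ring
      have h1 : 0 ≤ 1 - p := by linarith [hp.2]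
      have h2 : 0 ≤ p / 4 := by linarith [hp.1]
      have hcd : c d ^ 2 ≤ 1 := by
        have := hc.abs_le d (hl d List.mem_cons_self)
        rw [← sq_abs]; nlinarith [abs_nonneg (c d)]
      calc _ ≤ (1 - p) * (((x + c d - (1 - p) * c d) ^ 2 + 4 * l.length) / δ ^ 2) +
              p / 4 * ∑ s ∈ unitSteps,
                (((x + c s - (1 - p) * c d) ^ 2 + 4 * l.length) / δ ^ 2) :=
            add_le_add (mul_le_mul_of_nonneg_left (key d) h1)
              (mul_le_mul_of_nonneg_left (Finset.sum_le_sum fun s _ => key s) h2)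
        _ = ((1 - p) * ((x + c d - (1 - p) * c d) ^ 2 + 4 * l.length) +
              p / 4 * (4 * (x - (1 - p) * c d) ^ 2 + 2 + 4 * (4 * l.length))) / δ ^ 2 := by
            rw [← hc.mean_sq, ← Finset.sum_div, Finset.sum_add_distrib, Finset.sum_const,
              card_unitSteps]
            simp only [nsmul_eq_mul, Nat.cast_ofNat]
            ring
        _ ≤ _ := by
            refine div_le_div_of_nonneg_right ?_ (by positivity)
            push_cast [List.length_cons]
            -- One step raises the mean square by its variance p(1-p) c(d)² + p/2, for which the
            -- bound 4 is generous.
            have e : (1 - p) * ((x + c d - (1 - p) * c d) ^ 2 + 4 * l.length) +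
              p / 4 * (4 * (x - (1 - p) * c d) ^ 2 + 2 + 4 * (4 * l.length))
              = x ^ 2 + 4 * l.length + (p * (1 - p) * c d ^ 2 + p / 2) := by ring
            rw [e]
            have : p * (1 - p) * c d ^ 2 ≤ 1 := by
              have : p * (1 - p) ≤ 1 := by nlinarith [hp.1, hp.2]
              have h0 : 0 ≤ p * (1 - p) := mul_nonneg hp.1 h1
              nlinarith
            linarith [hp.2]

/-- The steps are independent, so the one-step bounds multiply; `v d` stands for a variance bound
for a step with instruction `d`. -/
theorem stepsExp_exp_le (hp : p ∈ Set.Icc (0 : ℝ) 1) {r : ℝ} {v : ℤ × ℤ → ℝ}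
    {l : List (ℤ × ℤ)} (h : ∀ d ∈ l, (1 - p) * Real.exp (r * c d) +
      p / 4 * ∑ s ∈ unitSteps, Real.exp (r * c s)
        ≤ Real.exp (r * ((1 - p) * c d) + r ^ 2 / 2 * v d)) :
    stepsExp p l (fun a => Real.exp (r * c a.sum))
      ≤ Real.exp (r * ((1 - p) * c l.sum) + r ^ 2 / 2 * (l.map v).sum) := by
  induction l with
  | nil => simp
  | cons d l ih =>
    have ih := ih fun d hd => h d (List.mem_cons_of_mem _ hd)
    have hd := h d List.mem_cons_self
    rw [stepsExp_cons]
    have e : ∀ s, stepsExp p l (fun a => Real.exp (r * c (s :: a).sum))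
        = Real.exp (r * c s) * stepsExp p l (fun a => Real.exp (r * c a.sum)) := by
      intro s
      rw [← stepsExp_mul_left]
      congr 1
      ext a
      rw [List.sum_cons, map_add, mul_add, Real.exp_add]
    simp only [e]
    rw [← Finset.sum_mul, ← mul_assoc, ← mul_assoc, ← add_mul]
    calc _ ≤ Real.exp (r * ((1 - p) * c d) + r ^ 2 / 2 * v d) *
          Real.exp (r * ((1 - p) * c l.sum) + r ^ 2 / 2 * (l.map v).sum) := by
          refine mul_le_mul hd ih ?_ (Real.exp_pos _).le
          rw [← stepsExp_const (p := p) l 0]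
          exact stepsExp_mono hp _ fun a => (Real.exp_pos _).le
      _ = _ := by
          rw [← Real.exp_add]
          simp only [List.sum_cons, map_add, List.map_cons]
          congr 1
          ring

theorem exp_le_quadratic_add_cube {u : ℝ} (hu : |u| ≤ 1) :
    Real.exp u ≤ 1 + u + u ^ 2 / 2 + |u| ^ 3 := by
  have h := Real.exp_bound hu (n := 3) (by norm_num)
  have h2 := (abs_le.1 h).2
  norm_num [Finset.sum_range_succ, Nat.factorial] at h2
  have : 0 ≤ |u| ^ 3 := by positivity
  linarith

/-- The exponential moments of one step are at most Gaussian with any larger variance `v`, for small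
parameters. -/
theorem exists_step_mgf_le (hp : p ∈ Set.Icc (0 : ℝ) 1) (hc : IsCoordinate c) {d : ℤ × ℤ}
    (hd : d ∈ unitSteps) {v : ℝ} (hv : p / 2 + p * (1 - p) * c d ^ 2 < v) :
    ∃ r₀ > 0, ∀ r : ℝ, |r| ≤ r₀ → (1 - p) * Real.exp (r * c d) +
      p / 4 * ∑ s ∈ unitSteps, Real.exp (r * c s)
        ≤ Real.exp (r * ((1 - p) * c d) + r ^ 2 / 2 * v) := by
  -- The exact variance of one step: the second moment (1-p) c(d)² + p/2 minus the square of the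
  -- mean (1-p) c(d).
  set V := p / 2 + p * (1 - p) * c d ^ 2 with hV
  have h1 : 0 ≤ 1 - p := by linarith [hp.2]
  have h2 : 0 ≤ p / 4 := by linarith [hp.1]
  -- The bound 1/2 keeps |r (c s - m)| ≤ 1; the other one makes the Taylor error 8|r|³ at most r²(v
  -- - V)/2.
  refine ⟨min (1 / 2) ((v - V) / 16), lt_min (by norm_num) (by linarith), fun r hr => ?_⟩
  have hr1 : |r| ≤ 1 / 2 := hr.trans (min_le_left _ _)
  have hr2 : |r| ≤ (v - V) / 16 := hr.trans (min_le_right _ _)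
  set m := (1 - p) * c d with hm
  have hm1 : |m| ≤ 1 := by
    rw [hm, abs_mul, abs_of_nonneg h1]
    have := hc.abs_le d hd
    nlinarith [abs_nonneg (c d), hp.1]
  have key : ∀ s ∈ unitSteps, Real.exp (r * c s) ≤ Real.exp (r * m) *
      (1 + r * (c s - m) + r ^ 2 / 2 * (c s - m) ^ 2 + 8 * |r| ^ 3) := by
    intro s hs
    have hb : |c s - m| ≤ 2 := (abs_sub _ _).trans (by linarith [hc.abs_le s hs])
    have hu : |r * (c s - m)| ≤ 2 * |r| := by
      rw [abs_mul]; nlinarith [abs_nonneg r]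
    have h3 := exp_le_quadratic_add_cube (hu.trans (by linarith))
    have h4 : |r * (c s - m)| ^ 3 ≤ (2 * |r|) ^ 3 := by gcongr
    have e : Real.exp (r * c s) = Real.exp (r * m) * Real.exp (r * (c s - m)) := by
      rw [← Real.exp_add]; ring_nf
    rw [e]
    refine mul_le_mul_of_nonneg_left ?_ (Real.exp_pos _).le
    refine h3.trans ?_
    rw [mul_pow] at *
    linarith
  calc _ ≤ (1 - p) * (Real.exp (r * m) *
        (1 + r * (c d - m) + r ^ 2 / 2 * (c d - m) ^ 2 + 8 * |r| ^ 3)) +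
        p / 4 * ∑ s ∈ unitSteps, (Real.exp (r * m) *
        (1 + r * (c s - m) + r ^ 2 / 2 * (c s - m) ^ 2 + 8 * |r| ^ 3)) :=
        add_le_add (mul_le_mul_of_nonneg_left (key d hd) h1)
          (mul_le_mul_of_nonneg_left (Finset.sum_le_sum key) h2)
    _ = Real.exp (r * m) * (1 + r ^ 2 / 2 * V + 8 * |r| ^ 3) := by
        have hq := hc.mean_sq 0 m
        simp only [zero_add, zero_sub] at hq
        rw [← Finset.mul_sum, Finset.sum_add_distrib, Finset.sum_add_distrib,
          Finset.sum_add_distrib, ← Finset.mul_sum, ← Finset.mul_sum, hq, Finset.sum_sub_distrib,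
          hc.sum_eq]
        simp only [Finset.sum_const, card_unitSteps, nsmul_eq_mul, Nat.cast_ofNat]
        rw [hV, hm]
        ring
    _ ≤ Real.exp (r * m) * Real.exp (r ^ 2 / 2 * v) := by
        refine mul_le_mul_of_nonneg_left ?_ (Real.exp_pos _).le
        refine le_trans ?_ (Real.add_one_le_exp _)
        have h5 : |r| ^ 3 = r ^ 2 * |r| := by rw [← sq_abs]; ring
        rw [h5]
        nlinarith [sq_nonneg r]
    _ = _ := by rw [← Real.exp_add]

end stepsExp

/-! ### Walks that have not yet visited their home -/

/-- The indicator of the event that the walk with start `x` and steps `a` does not visit `home`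
after its start. -/
def aliveInd (home : ℤ × ℤ) : ℤ × ℤ → List (ℤ × ℤ) → ℝ
  | _, [] => 1
  | x, s :: a => if x + s = home then 0 else aliveInd home (x + s) a

section survival

variable {p : ℝ} {home : ℤ × ℤ}

theorem aliveInd_nonneg (x : ℤ × ℤ) (a : List (ℤ × ℤ)) : 0 ≤ aliveInd home x a := by
  induction a generalizing x with
  | nil => exact zero_le_one
  | cons s a ih => rw [aliveInd]; split_ifs; exacts [le_rfl, ih _]

theorem aliveInd_le_one (x : ℤ × ℤ) (a : List (ℤ × ℤ)) : aliveInd home x a ≤ 1 := by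
  induction a generalizing x with
  | nil => exact le_rfl
  | cons s a ih => rw [aliveInd]; split_ifs; exacts [zero_le_one, ih _]

theorem aliveInd_append (x : ℤ × ℤ) (a b : List (ℤ × ℤ)) :
    aliveInd home x (a ++ b) = aliveInd home x a * aliveInd home (x + a.sum) b := by
  induction a generalizing x with
  | nil => simp [aliveInd]
  | cons s a ih =>
    simp only [List.cons_append, aliveInd, ih, List.sum_cons, add_assoc]
    split_ifs <;> simp

theorem aliveInd_eq_zero {x : ℤ × ℤ} {a : List (ℤ × ℤ)} (ha : a ≠ []) (h : x + a.sum = home)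
    (b : List (ℤ × ℤ)) : aliveInd home x (a ++ b) = 0 := by
  obtain ⟨a', s, rfl⟩ := List.eq_nil_or_concat' a |>.resolve_left ha
  simp only [List.sum_append, List.sum_cons, List.sum_nil, add_zero, ← add_assoc] at h
  simp [aliveInd_append, aliveInd, h]

/-- The expectation of a function of the final position of the agent on the event that the agent,
starting at `x` and given the instructions `l`, does not visit `home` after its start. -/
noncomputable def survOp (p : ℝ) (home : ℤ × ℤ) (l : List (ℤ × ℤ)) :
    (ℤ × ℤ → ℝ) →ₗ[ℝ] (ℤ × ℤ → ℝ) where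
  toFun f x := stepsExp p l fun a => aliveInd home x a * f (x + a.sum)
  map_add' f g := by
    ext x
    simp only [Pi.add_apply, mul_add]
    exact stepsExp_add _ _ _
  map_smul' r f := by
    ext x
    simp only [Pi.smul_apply, smul_eq_mul, RingHom.id_apply, mul_left_comm _ r]
    exact stepsExp_mul_left _ _ _

theorem survOp_apply (l : List (ℤ × ℤ)) (f : ℤ × ℤ → ℝ) (x : ℤ × ℤ) :
    survOp p home l f x = stepsExp p l fun a => aliveInd home x a * f (x + a.sum) := rfl

theorem survOp_nil (f : ℤ × ℤ → ℝ) : survOp p home [] f = f := by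
  ext x; simp [survOp_apply, aliveInd]

theorem survOp_singleton (d : ℤ × ℤ) (f : ℤ × ℤ → ℝ) (x : ℤ × ℤ) :
    survOp p home [d] f x = (1 - p) * (if x + d = home then 0 else f (x + d)) +
      p / 4 * ∑ s ∈ unitSteps, if x + s = home then 0 else f (x + s) := by
  simp [survOp_apply, stepsExp_cons, aliveInd]

theorem survOp_append (l₁ l₂ : List (ℤ × ℤ)) (f : ℤ × ℤ → ℝ) :
    survOp p home (l₁ ++ l₂) f = survOp p home l₁ (survOp p home l₂ f) := by
  ext x
  simp only [survOp_apply, stepsExp_append, aliveInd_append, List.sum_append, ← stepsExp_mul_left,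
    mul_assoc, add_assoc]

theorem survOp_mono (hp : p ∈ Set.Icc (0 : ℝ) 1) (l : List (ℤ × ℤ)) {f g : ℤ × ℤ → ℝ}
    (h : f ≤ g) : survOp p home l f ≤ survOp p home l g := fun _ =>
  stepsExp_mono hp _ fun _ => mul_le_mul_of_nonneg_left (h _) (aliveInd_nonneg _ _)

/-- Ignoring the killing only increases the expectation, and instructions with sum zero leave no
drift term. -/
theorem survOp_exp_le (hp : p ∈ Set.Icc (0 : ℝ) 1) {c : ℤ × ℤ →+ ℝ} {r : ℝ} {v : ℤ × ℤ → ℝ}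
    {l : List (ℤ × ℤ)} (h : ∀ d ∈ l, (1 - p) * Real.exp (r * c d) +
      p / 4 * ∑ s ∈ unitSteps, Real.exp (r * c s)
        ≤ Real.exp (r * ((1 - p) * c d) + r ^ 2 / 2 * v d)) (hl : l.sum = 0) (x : ℤ × ℤ) :
    survOp p home l (fun y => Real.exp (r * c y)) x
      ≤ Real.exp (r ^ 2 / 2 * (l.map v).sum) * Real.exp (r * c x) := by
  have h1 := stepsExp_exp_le hp h
  rw [hl, map_zero, mul_zero, mul_zero, zero_add] at h1
  calc _ ≤ stepsExp p l (fun a => Real.exp (r * c x) * Real.exp (r * c a.sum)) := by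
        rw [survOp_apply]
        refine stepsExp_mono hp _ fun a => ?_
        rw [map_add, mul_add, Real.exp_add]
        exact mul_le_of_le_one_left (by positivity) (aliveInd_le_one _ _)
    _ = Real.exp (r * c x) * stepsExp p l (fun a => Real.exp (r * c a.sum)) :=
        stepsExp_mul_left _ _ _
    _ ≤ Real.exp (r * c x) * Real.exp (r ^ 2 / 2 * (l.map v).sum) := by gcongr
    _ = _ := mul_comm _ _

/-! ### The geometry of a phase -/

/-- Locates line j, counted from zero, as a contiguous block of instructions: lines with even j run
in the direction of the first line, the others backwards. -/
theorem sweepLines_take (W G : ℕ) (n : ℕ) (east : Bool) (j : ℕ) (hj : j < n) :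
    ∃ k, k + 2 * W ≤ (sweepLines W G n east).length ∧ ∀ m ≤ 2 * W,
      ((sweepLines W G n east).take (k + m)).sum =
        ((if east then 1 else -1) * (if Even j then (m : ℤ) else 2 * W - m), (j * G : ℤ)) := by
  have hrep : ∀ m ≤ 2 * W, ((List.replicate (2 * W) (if east then ((1 : ℤ), (0 : ℤ))
      else (-1, 0))).take m).sum = ((if east then 1 else -1) * (m : ℤ), 0) := by
    intro m hm
    rw [List.take_replicate, min_eq_left hm, List.sum_replicate]
    cases east <;> simp
  induction n, east using sweepLines.induct generalizing j with
  | case1 => omega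
  | case2 east =>
    obtain rfl : j = 0 := by omega
    refine ⟨0, by simp [sweepLines], fun m hm => ?_⟩
    rw [sweepLines, zero_add, hrep m hm]
    simp
  | case3 n east ih =>
    cases j with
    | zero =>
      refine ⟨0, by simp [sweepLines], fun m hm => ?_⟩
      rw [sweepLines, List.append_assoc, List.take_append_of_le_length (by simpa using hm), zero_add,
        hrep m hm]
      simp
    | succ j =>
      obtain ⟨k, hk, h⟩ := ih j (by omega) (by
        intro m hm
        rw [List.take_replicate, min_eq_left hm, List.sum_replicate]
        cases east <;> simp)
      refine ⟨2 * W + G + k, by simp [sweepLines]; omega, fun m hm => ?_⟩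
      have e : 2 * W + G + k + m = (List.replicate (2 * W) (if east then ((1 : ℤ), (0 : ℤ))
        else (-1, 0)) ++ List.replicate G (0, 1)).length + (k + m) := by
        simp; omega
      rw [sweepLines, e, List.take_length_add_append, List.sum_append, h m hm, List.sum_append,
        List.sum_replicate, List.sum_replicate]
      ext
      · cases east <;> by_cases hj : Even j <;> simp [hj, Nat.even_add_one] <;> ring
      · cases east <;> simp <;> ring

theorem mem_unitSteps_of_mem_sweepLines {W G n : ℕ} {east : Bool} {d : ℤ × ℤ}
    (h : d ∈ sweepLines W G n east) : d ∈ unitSteps := by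
  induction n, east using sweepLines.induct with
  | case1 => simp [sweepLines] at h
  | case2 east =>
    rw [sweepLines] at h
    rw [List.eq_of_mem_replicate h]
    cases east <;> decide
  | case3 n east ih =>
    rw [sweepLines, List.mem_append, List.mem_append] at h
    rcases h with (h | h) | h
    · rw [List.eq_of_mem_replicate h]
      cases east <;> decide
    · rw [List.eq_of_mem_replicate h]
      decide
    · exact ih h

/-- All fluctuations of the steps `a`, given the instructions `l`, are smaller than `δ`. -/
def IsClose (p δ : ℝ) (l a : List (ℤ × ℤ)) : Prop :=
  (∀ k ≤ l.length, |fstCoord (a.take k).sum - (1 - p) * fstCoord (l.take k).sum| < δ) ∧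
  (∀ k ≤ l.length, |sndCoord (a.take k).sum - (1 - p) * sndCoord (l.take k).sum| < δ)

open Classical in
theorem stepsExp_not_isClose_le (hp : p ∈ Set.Icc (0 : ℝ) 1) {δ : ℝ} (hδ : 0 < δ)
    (l : List (ℤ × ℤ)) (hl : ∀ d ∈ l, d ∈ unitSteps) :
    stepsExp p l (fun a => if IsClose p δ l a then 0 else 1) ≤ 8 * l.length / δ ^ 2 := by
  have h1 := stepsExp_max_deviation hp isCoordinate_fst hδ l hl 0
  have h2 := stepsExp_max_deviation hp isCoordinate_snd hδ l hl 0
  refine le_trans (stepsExp_mono hp l fun a => ?_) ((stepsExp_add l _ _).trans_le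
    ((add_le_add h1 h2).trans_eq (by ring)))
  simp only [zero_add]
  by_cases h3 : ∃ k ≤ l.length, δ ≤ |fstCoord (a.take k).sum - (1 - p) * fstCoord (l.take k).sum|
  · rw [if_pos h3]; split_ifs <;> norm_num
  by_cases h4 : ∃ k ≤ l.length, δ ≤ |sndCoord (a.take k).sum - (1 - p) * sndCoord (l.take k).sum|
  · rw [if_pos h4]; split_ifs <;> norm_num
  push Not at h3 h4
  rw [if_pos ⟨h3, h4⟩]
  split_ifs <;> norm_num

theorem sum_take_succ_sub_mem {a : List (ℤ × ℤ)} (ha : ∀ s ∈ a, s ∈ unitSteps) {k : ℕ}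
    (hk : k < a.length) : (a.take (k + 1)).sum - (a.take k).sum ∈ unitSteps := by
  rw [List.sum_take_succ _ _ hk, add_sub_cancel_left]
  exact ha _ (List.getElem_mem hk)

/-- If the fluctuations are small, then the walks with all offsets together hit their target. -/
theorem exists_offset_hits (hp0 : 0 ≤ p) (hp1 : p < 1) {δ : ℝ} {W H G N M : ℕ}
    (hδ : 0 < δ) (hG : 0 < G) {u : ℤ × ℤ} (hM : 6 * δ + 2 ≤ (1 - p) * ((M : ℝ) - G))
    (hx : |(u.1 : ℝ)| + 3 * δ < (1 - p) * W)
    (hy : 3 * δ + (1 - p) < u.2 + (1 - p) * H) (hy' : u.2 + (1 - p) * H ≤ (1 - p) * (N * G))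
    {a₀ a b : List (ℤ × ℤ)}
    (ha : a.length = M) (hb : b.length = (sweepLines W G N true).length)
    (ha' : ∀ s ∈ a, s ∈ unitSteps) (hb' : ∀ s ∈ b, s ∈ unitSteps)
    (hca₀ : IsClose p δ (List.replicate W (-1, 0) ++ List.replicate H (0, -1)) a₀)
    (ha₀ : a₀.length = W + H)
    (hca : IsClose p δ (List.replicate M (0, 1)) a)
    (hcb : IsClose p δ (sweepLines W G N true) b) :
    ∃ z ∈ Finset.Icc 1 M, ∃ k ≤ b.length, a₀.sum + (a.take z).sum + (b.take k).sum = u := by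
  have h1p : 0 < 1 - p := by linarith
  have hG' : (0 : ℝ) < G := by exact_mod_cast hG
  have hM1 : 1 ≤ M := by
    by_contra h
    obtain rfl : M = 0 := by omega
    have : 0 ≤ (1 - p) * (G : ℝ) := by positivity
    push_cast at hM
    linarith
  set Y : ℝ := u.2 + (1 - p) * H with hY
  -- Y is the mean height of the target above the corner. Line j is the highest one from which the
  -- target is still safely above the lowest offset: the offset 1 contributes 1 - p, and the
  -- approach, the northward run and the line each contribute an error up to δ. By maximality the
  -- target is less than one further gap (1-p)G above, which `hM` fits below the largest offset.
  set j := ⌊(Y - (1 - p) - 3 * δ) / ((1 - p) * G)⌋₊ with hj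
  have hj1 : (j : ℝ) * ((1 - p) * G) ≤ Y - (1 - p) - 3 * δ :=
    (le_div_iff₀ (by positivity)).1 (Nat.floor_le (div_nonneg (by linarith) (by positivity)))
  have hj2 : Y - (1 - p) - 3 * δ < (j + 1) * ((1 - p) * G) :=
    (div_lt_iff₀ (by positivity)).1 (Nat.lt_floor_add_one _)
  have hjN : j < N := by
    have : (j : ℝ) * ((1 - p) * G) < N * ((1 - p) * G) := by nlinarith
    exact_mod_cast lt_of_mul_lt_mul_right this (by positivity)
  obtain ⟨k₀, hk₀, hline⟩ := sweepLines_take W G N true j hjN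
  -- the indices at which the line is traversed, ordered from east to west
  obtain ⟨idx, hidx1, hidx2, hidx3⟩ : ∃ idx : ℕ → ℕ,
      (∀ m ≤ 2 * W, idx m ≤ b.length) ∧
      (∀ m ≤ 2 * W, ((sweepLines W G N true).take (idx m)).sum = (2 * (W : ℤ) - m, (j * G : ℤ))) ∧
      (∀ m < 2 * W, idx (m + 1) = idx m + 1 ∨ idx m = idx (m + 1) + 1) := by
    by_cases hev : Even j
    · refine ⟨fun m => k₀ + (2 * W - m), fun m hm => by simp only [hb]; omega, fun m hm => ?_,
        fun m hm => by right; simp only; omega⟩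
      rw [hline _ (by omega)]
      simp only [hev]
      ext <;> simp
      omega
    · refine ⟨fun m => k₀ + m, fun m hm => by simp only [hb]; omega, fun m hm => ?_,
        fun m hm => by left; simp only; omega⟩
      rw [hline _ hm]
      simp [hev]
  have hpre := And.intro (hca₀.1 (W + H) (by simp [List.length_append, List.length_replicate]))
    (hca₀.2 (W + H) (by simp [List.length_append, List.length_replicate]))
  rw [List.take_of_length_le (by omega), List.take_of_length_le (by simp)] at hpre
  simp only [List.sum_append, List.sum_replicate, fstCoord_apply, sndCoord_apply] at hpre
  have hSx : ∀ i ≤ M, |(((a.take i).sum).1 : ℝ)| < δ ∧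
      |(((a.take i).sum).2 : ℝ) - (1 - p) * i| < δ := by
    intro i hi
    have h1 := hca.1 i (by simpa using hi)
    have h2 := hca.2 i (by simpa using hi)
    simp only [List.take_replicate, min_eq_left hi, List.sum_replicate, fstCoord_apply,
      sndCoord_apply] at h1 h2
    simp at h1 h2
    exact ⟨h1, h2⟩
  have hQx : ∀ m ≤ 2 * W, |(((b.take (idx m)).sum).1 : ℝ) - (1 - p) * (2 * W - m)| < δ ∧
      |(((b.take (idx m)).sum).2 : ℝ) - (1 - p) * (j * G)| < δ := by
    intro m hm
    have h0 := hidx1 m hm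
    have h1 := hcb.1 (idx m) (by omega)
    have h2 := hcb.2 (idx m) (by omega)
    rw [hidx2 m hm] at h1 h2
    simp only [fstCoord_apply, sndCoord_apply] at h1 h2
    push_cast at h1 h2
    exact ⟨h1, h2⟩
  simp at hpre
  obtain ⟨hp1, hp2⟩ := hpre
  rw [abs_lt] at hp1 hp2
  have hneg : ∀ s ∈ unitSteps, -s ∈ unitSteps := by decide
  have hux := abs_lt.1 (show |(u.1 : ℝ)| < (1 - p) * W - 3 * δ by linarith)
  -- Hitting `u` with offset z at index k of the lines means that the northward path at z equals `u
  -- - a₀.sum` minus the line path at k. Offsets start at 1, hence the shift in S. The sign reverses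
  -- the line, which `idx` lists from east to west, so Q runs from left to right.
  obtain ⟨i, hi, m, hm, him⟩ := exists_common_point (S := fun i => (a.take (i + 1)).sum)
    (Q := fun m => u - a₀.sum - (b.take (idx m)).sum) (m := M - 1) (n := 2 * W)
    (fun i hi => sum_take_succ_sub_mem ha' (by omega))
    (fun m hm => by
      have e1 := hidx1 m (by omega)
      have e2 := hidx1 (m + 1) (by omega)
      rcases hidx3 m hm with h | h
      · have := hneg _ (sum_take_succ_sub_mem hb' (k := idx m) (by omega))
        rw [← h] at this
        convert this using 1; abel
      · have := sum_take_succ_sub_mem hb' (k := idx (m + 1)) (by omega)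
        rw [← h] at this
        convert this using 1; abel)
    (fun i hi => by
      have h1 := abs_lt.1 (hSx (i + 1) (by omega)).1
      have h2 := abs_lt.1 (hQx 0 (by omega)).1
      have : ((u - a₀.sum - (b.take (idx 0)).sum).1 : ℝ) < ((a.take (i + 1)).sum).1 := by
        push_cast [Prod.fst_sub] at h2 ⊢
        linarith
      exact_mod_cast this)
    (fun i hi => by
      have h1 := abs_lt.1 (hSx (i + 1) (by omega)).1
      have h2 := abs_lt.1 (hQx (2 * W) le_rfl).1
      have : (((a.take (i + 1)).sum).1 : ℝ) < (u - a₀.sum - (b.take (idx (2 * W))).sum).1 := by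
        push_cast [Prod.fst_sub] at h2 ⊢
        linarith
      exact_mod_cast this)
    (fun m hm => by
      have h1 := abs_lt.1 (hSx 1 (by omega)).2
      have h2 := abs_lt.1 (hQx m hm).2
      have : (((a.take (0 + 1)).sum).2 : ℝ) < (u - a₀.sum - (b.take (idx m)).sum).2 := by
        push_cast [Prod.snd_sub] at h1 h2 ⊢
        linarith
      exact_mod_cast this)
    (fun m hm => by
      have h1 := abs_lt.1 (hSx M le_rfl).2
      have h2 := abs_lt.1 (hQx m hm).2
      have : ((u - a₀.sum - (b.take (idx m)).sum).2 : ℝ) + 1 < ((a.take (M - 1 + 1)).sum).2 := by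
        push_cast [Prod.snd_sub] at h1 h2 ⊢
        rw [Nat.sub_add_cancel hM1]
        linarith
      exact_mod_cast this)
  refine ⟨i + 1, Finset.mem_Icc.2 (by omega), idx m, hidx1 m hm, ?_⟩
  rw [him]
  abel

end survival

/-! ### Hitting probabilities summed over coupled offsets -/

section hitting

variable {p : ℝ} {home : ℤ × ℤ}

open Classical in
-- This is the coupling: the z northward steps are the first z of the same M steps for every z, and
-- the steps after the lines are discarded. One triple of step lists then decides the hits for all
-- offsets.
theorem survOp_one_le_of_hits (hp : p ∈ Set.Icc (0 : ℝ) 1) {pre lines post : List (ℤ × ℤ)} {M z : ℕ}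
    (hz : z ∈ Finset.Icc 1 M) (x : ℤ × ℤ) :
    survOp p home (pre ++ (List.replicate z (0, 1) ++ (lines ++ post))) 1 x ≤
      stepsExp p pre (fun a₀ => stepsExp p (List.replicate M (0, 1)) (fun a =>
        stepsExp p lines (fun b => 1 - if ∃ k ≤ b.length,
          a₀.sum + (a.take z).sum + (b.take k).sum = home - x then 1 else 0))) := by
  obtain ⟨hz1, hz2⟩ := Finset.mem_Icc.1 hz
  simp only [survOp_apply, stepsExp_append, Pi.one_apply, mul_one]
  refine stepsExp_mono hp _ fun a₀ => ?_
  have e : List.replicate z ((0 : ℤ), (1 : ℤ)) = (List.replicate M (0, 1)).take z := by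
    rw [List.take_replicate, min_eq_left hz2]
  rw [e, stepsExp_take (by simpa using hz2)]
  refine stepsExp_mono_of_unitSteps hp
    (fun d hd => by rw [List.eq_of_mem_replicate hd]; decide) fun a ha _ => ?_
  refine stepsExp_mono hp _ fun b => ?_
  rw [← stepsExp_const (p := p) post (1 - _)]
  refine stepsExp_mono hp _ fun c => ?_
  split_ifs with h
  · obtain ⟨k, hk, hk'⟩ := h
    rw [sub_self]
    refine le_of_eq ?_
    have e2 : a₀ ++ (a.take z ++ (b ++ c))
        = (a₀ ++ (a.take z ++ b.take k)) ++ (b.drop k ++ c) := by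
      simp only [List.append_assoc]
      rw [← List.append_assoc (b.take k), List.take_append_drop]
    rw [e2]
    apply aliveInd_eq_zero
    · intro h0
      have := congrArg List.length h0
      simp only [List.length_append, List.length_take, List.length_replicate, List.length_nil]
        at this ha
      omega
    · simp only [List.sum_append, ← add_assoc] at hk' ⊢
      rw [add_assoc x, add_assoc x, hk']
      abel
  · simpa using aliveInd_le_one _ _

/-- The hitting probabilities for all offsets add up to almost one. -/
theorem sum_hitting_ge (hp0 : 0 ≤ p) (hp1 : p < 1) {δ : ℝ} {W H G N M : ℕ}
    (hδ : 0 < δ) (hG : 0 < G) {x : ℤ × ℤ} (hM : 6 * δ + 2 ≤ (1 - p) * ((M : ℝ) - G))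
    (hx : |((home - x).1 : ℝ)| + 3 * δ < (1 - p) * W)
    (hy : 3 * δ + (1 - p) < (home - x).2 + (1 - p) * H)
    (hy' : (home - x).2 + (1 - p) * H ≤ (1 - p) * (N * G)) (post : ℕ → List (ℤ × ℤ)) :
    1 - 8 * (W + H + M + (sweepLines W G N true).length : ℝ) / δ ^ 2 ≤
      ∑ z ∈ Finset.Icc 1 M, (1 - survOp p home
        ((List.replicate W (-1, 0) ++ List.replicate H (0, -1)) ++ (List.replicate z (0, 1) ++
          (sweepLines W G N true ++ post z))) 1 x) := by
  classical
  have hp : p ∈ Set.Icc (0 : ℝ) 1 := ⟨hp0, hp1.le⟩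
  set pre : List (ℤ × ℤ) := List.replicate W (-1, 0) ++ List.replicate H (0, -1) with hpre
  set up : List (ℤ × ℤ) := List.replicate M (0, 1) with hup
  set lines := sweepLines W G N true with hlines
  have hprel : pre.length = W + H := by simp [hpre]
  have hupl : up.length = M := by simp [hup]
  have hpreu : ∀ d ∈ pre, d ∈ unitSteps := by
    intro d hd
    rcases List.mem_append.1 hd with h | h <;> rw [List.eq_of_mem_replicate h] <;> decide
  have hupu : ∀ d ∈ up, d ∈ unitSteps := by
    intro d hd
    rw [List.eq_of_mem_replicate hd]; decide
  have hlinesu : ∀ d ∈ lines, d ∈ unitSteps := fun d hd => mem_unitSteps_of_mem_sweepLines hd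
  set hit : List (ℤ × ℤ) → List (ℤ × ℤ) → List (ℤ × ℤ) → ℕ → ℝ := fun a₀ a b z =>
    if ∃ k ≤ b.length, a₀.sum + (a.take z).sum + (b.take k).sum = home - x then 1 else 0 with hhit
  set bad : List (ℤ × ℤ) → List (ℤ × ℤ) → ℝ := fun l a => if IsClose p δ l a then 0 else 1
    with hbad
  have hbad0 : ∀ l a, 0 ≤ bad l a := fun l a => by simp only [hbad]; split_ifs <;> norm_num
  have hhit0 : ∀ a₀ a b z, 0 ≤ hit a₀ a b z := fun a₀ a b z => by
    simp only [hhit]; split_ifs <;> norm_num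
  have h1 : ∀ z ∈ Finset.Icc 1 M, stepsExp p pre (fun a₀ => stepsExp p up (fun a =>
      stepsExp p lines (fun b => hit a₀ a b z))) ≤
      1 - survOp p home (pre ++ (List.replicate z (0, 1) ++ (lines ++ post z))) 1 x := by
    intro z hz
    have h := survOp_one_le_of_hits (home := home) hp (pre := pre) (lines := lines)
      (post := post z) hz x
    simp only [stepsExp_sub, stepsExp_const] at h
    linarith
  refine le_trans ?_ (Finset.sum_le_sum h1)
  simp only [← stepsExp_sum]
  calc _ ≤ stepsExp p pre (fun a₀ => stepsExp p up (fun a => stepsExp p lines (fun b =>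
        1 - bad pre a₀ - bad up a - bad lines b))) := by
        simp only [stepsExp_sub, stepsExp_const]
        have e1 := stepsExp_not_isClose_le hp hδ pre hpreu
        have e2 := stepsExp_not_isClose_le hp hδ up hupu
        have e3 := stepsExp_not_isClose_le hp hδ lines hlinesu
        rw [hprel] at e1
        rw [hupl] at e2
        have e4 : 8 * (W + H + M + lines.length : ℝ) / δ ^ 2 = 8 * ((W + H : ℕ) : ℝ) / δ ^ 2
          + 8 * M / δ ^ 2 + 8 * lines.length / δ ^ 2 := by push_cast; ring
        rw [e4]
        simp only [hbad]
        linarith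
    _ ≤ _ := by
        refine stepsExp_mono_of_unitSteps hp hpreu fun a₀ ha₀ _ => ?_
        refine stepsExp_mono_of_unitSteps hp hupu fun a ha ha' => ?_
        refine stepsExp_mono_of_unitSteps hp hlinesu fun b hb hb' => ?_
        -- On the good event some offset hits, so the sum is at least 1; otherwise the left side is
        -- at most 0.
        by_cases hgood : IsClose p δ pre a₀ ∧ IsClose p δ up a ∧ IsClose p δ lines b
        · obtain ⟨z, hz, hk⟩ := exists_offset_hits hp0 hp1 hδ hG hM hx hy hy' (ha.trans hupl) hb
            ha' hb' hgood.1 (ha₀.trans hprel) hgood.2.1 hgood.2.2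
          have e5 : hit a₀ a b z = 1 := if_pos hk
          have e6 := Finset.single_le_sum (f := hit a₀ a b) (fun z _ => hhit0 a₀ a b z) hz
          linarith [hbad0 pre a₀, hbad0 up a, hbad0 lines b]
        · have e7 : 1 ≤ bad pre a₀ + bad up a + bad lines b := by
            rw [not_and_or, not_and_or] at hgood
            rcases hgood with h | h | h
            · have : bad pre a₀ = 1 := if_neg h
              linarith [hbad0 up a, hbad0 lines b]
            · have : bad up a = 1 := if_neg h
              linarith [hbad0 pre a₀, hbad0 lines b]
            · have : bad lines b = 1 := if_neg h
              linarith [hbad0 up a, hbad0 pre a₀]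
          have e8 := Finset.sum_nonneg (s := Finset.Icc 1 M) (fun z _ => hhit0 a₀ a b z)
          linarith

end hitting

/-! ### Phases -/

theorem sum_map_sweepLines {v : ℤ × ℤ → ℝ} {vh vv : ℝ} (h1 : v (1, 0) = vh) (h2 : v (-1, 0) = vh)
    (h3 : v (0, 1) = vv) (W G n : ℕ) (east : Bool) :
    ((sweepLines W G (n + 1) east).map v).sum = (n + 1) * (2 * W) * vh + n * G * vv := by
  induction n generalizing east with
  | zero => cases east <;> simp [sweepLines, h1, h2]
  | succ n ih =>
    rw [sweepLines]
    simp only [List.map_append, List.sum_append, ih]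
    cases east <;> simp [h1, h2, h3] <;> ring

theorem sum_sweepLines (W G n : ℕ) (east : Bool) :
    (sweepLines W G (n + 1) east).sum =
      ((if east then 1 else -1) * (if Even n then 2 * (W : ℤ) else 0), (n * G : ℤ)) := by
  induction n generalizing east with
  | zero => cases east <;> simp [sweepLines]
  | succ n ih =>
    rw [sweepLines]
    simp only [List.sum_append, ih]
    cases east <;> by_cases hn : Even n <;> simp [hn, Nat.even_add_one] <;> ring

namespace SweepParams

variable (P : SweepParams)

theorem phase_eq (t z : ℕ) : ∃ post, P.phase t z =
    (List.replicate (P.W t) (-1, 0) ++ List.replicate (P.H t) (0, -1)) ++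
      (List.replicate z (0, 1) ++ (sweepLines (P.W t) (P.G t) (P.N t) true ++ post)) :=
  ⟨List.replicate (P.M t - z) (0, 1) ++
    (List.replicate (P.W t) (if Odd (P.N t) then (-1, 0) else (1, 0)) ++
      List.replicate ((P.N t - 1) * P.G t + P.M t - P.H t) (0, -1)),
    by simp only [phase, List.append_assoc]⟩

theorem mem_unitSteps_of_mem_phase {t z : ℕ} {d : ℤ × ℤ} (h : d ∈ P.phase t z) :
    d ∈ unitSteps := by
  simp only [phase, List.mem_append] at h
  rcases h with (((((h | h) | h) | h) | h) | h) | h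
  · rw [List.eq_of_mem_replicate h]; decide
  · rw [List.eq_of_mem_replicate h]; decide
  · rw [List.eq_of_mem_replicate h]; decide
  · exact mem_unitSteps_of_mem_sweepLines h
  · rw [List.eq_of_mem_replicate h]; decide
  · rw [List.eq_of_mem_replicate h]; split_ifs <;> decide
  · rw [List.eq_of_mem_replicate h]; decide

variable {P} {t z : ℕ}

theorem two_H_le (hG : 0 < P.G t) : 2 * P.H t ≤ P.N t * P.G t := by
  have h := Nat.le_ceil ((2 * P.H t : ℝ) / P.G t)
  have hG' : (0 : ℝ) < P.G t := by exact_mod_cast hG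
  rw [div_le_iff₀ hG', ← N] at h
  exact_mod_cast h

theorem N_pos (hG : 0 < P.G t) (hH : 0 < P.H t) : 0 < P.N t :=
  Nat.pos_of_mul_pos_right (b := P.G t) (by have := two_H_le hG; omega)

/-- Ensures that the subtraction in the last leg of `phase` is not truncated. -/
theorem H_le (hG : 0 < P.G t) : P.H t ≤ (P.N t - 1) * P.G t + P.M t := by
  have h1 := two_H_le hG
  have h2 : P.N t * P.G t ≤ (P.N t - 1) * P.G t + P.G t := by
    rw [← Nat.succ_mul]; exact Nat.mul_le_mul_right _ (by omega)
  have h3 : P.G t ≤ P.M t := Nat.le_add_right _ _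
  omega

/-- One count for two uses: v = 1 gives the duration, and a variance bound per step gives that of
the phase. The result is free of `z`. -/
theorem sum_map_phase {v : ℤ × ℤ → ℝ} {vh vv : ℝ} (h1 : v (1, 0) = vh) (h2 : v (-1, 0) = vh)
    (h3 : v (0, 1) = vv) (h4 : v (0, -1) = vv) (hG : 0 < P.G t) (hH : 0 < P.H t)
    (hz : z ≤ P.M t) :
    ((P.phase t z).map v).sum = (2 * P.W t * (P.N t + 1)) * vh +
      (2 * ((P.N t - 1) * P.G t) + 2 * P.M t) * vv := by
  have hN := N_pos hG hH
  have hle := H_le hG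
  obtain ⟨n, hn⟩ : ∃ n, P.N t = n + 1 := ⟨P.N t - 1, by omega⟩
  rw [hn] at hle
  simp only [phase, List.map_append, List.sum_append, hn, sum_map_sweepLines h1 h2 h3,
    List.map_replicate, List.sum_replicate, h2, h3, h4, nsmul_eq_mul]
  rw [Nat.cast_sub hz, Nat.cast_sub hle]
  have e : v (if Odd (n + 1) then (-1, 0) else (1, 0)) = vh := by split_ifs <;> assumption
  rw [e]
  push_cast [Nat.add_sub_cancel]
  ring

theorem length_phase (hG : 0 < P.G t) (hH : 0 < P.H t) (hz : z ≤ P.M t) :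
    ((P.phase t z).length : ℝ) = 2 * P.W t * (P.N t + 1) +
      (2 * ((P.N t - 1) * P.G t) + 2 * P.M t) := by
  have h := sum_map_phase (v := fun _ => 1) (vh := 1) (vv := 1) rfl rfl rfl rfl hG hH hz
  simpa using h

theorem sum_phase (hG : 0 < P.G t) (hH : 0 < P.H t) (hz : z ≤ P.M t) :
    (P.phase t z).sum = 0 := by
  have hN := N_pos hG hH
  have hle := H_le hG
  obtain ⟨n, hn⟩ : ∃ n, P.N t = n + 1 := ⟨P.N t - 1, by omega⟩
  rw [hn] at hle
  simp only [phase, List.sum_append, hn, sum_sweepLines, List.sum_replicate]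
  ext
  · by_cases hn : Even n
    · simp [hn, -Nat.not_even_iff_odd]
      ring
    · simp [hn, ← Nat.not_even_iff_odd]
  · simp only [Prod.snd_add, Prod.smul_mk, nsmul_eq_mul, Nat.cast_sub hz, Nat.cast_sub hle]
    split_ifs <;> push_cast [Nat.add_sub_cancel] <;> simp <;> ring

end SweepParams

/-! ### Asymptotics of the parameters of a phase -/

section growth

open Filter Topology

theorem tendsto_sqrt_natCast : Tendsto (fun t : ℕ => √(t : ℝ)) atTop atTop :=
  Real.tendsto_sqrt_atTop.comp tendsto_natCast_atTop_atTop

theorem tendsto_log_natCast : Tendsto (fun t : ℕ => Real.log t) atTop atTop :=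
  Real.tendsto_log_atTop.comp tendsto_natCast_atTop_atTop

theorem tendsto_cbrt_natCast : Tendsto (fun t : ℕ => (t : ℝ) ^ (1 / 3 : ℝ)) atTop atTop :=
  (tendsto_rpow_atTop (by norm_num)).comp tendsto_natCast_atTop_atTop

/-- Since ln t = o(t^(1/6)), the surplus t^(1/3) in `M` is negligible compared with the gap `G`. -/
theorem tendsto_cbrt_mul_log_div_sqrt :
    Tendsto (fun t : ℕ => (t : ℝ) ^ (1 / 3 : ℝ) / (√(t : ℝ) / Real.log t)) atTop (𝓝 0) := by
  have h := (isLittleO_log_rpow_atTop (r := 1 / 6) (by norm_num)).tendsto_div_nhds_zero.comp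
    (tendsto_natCast_atTop_atTop (R := ℝ))
  refine h.congr' ?_
  filter_upwards [eventually_ge_atTop 1] with t ht
  have ht' : (0 : ℝ) < t := by exact_mod_cast ht
  have e : √(t : ℝ) = (t : ℝ) ^ (1 / 3 : ℝ) * (t : ℝ) ^ (1 / 6 : ℝ) := by
    rw [Real.sqrt_eq_rpow, ← Real.rpow_add ht']; norm_num
  have h1 : (0 : ℝ) < (t : ℝ) ^ (1 / 3 : ℝ) := by positivity
  have h2 : (0 : ℝ) < (t : ℝ) ^ (1 / 6 : ℝ) := by positivity
  simp only [Function.comp_apply]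
  rw [e]
  field_simp

theorem tendsto_sqrt_div_log :
    Tendsto (fun t : ℕ => √(t : ℝ) / Real.log t) atTop atTop := by
  have h := tendsto_cbrt_mul_log_div_sqrt.eventually (gt_mem_nhds (show (0 : ℝ) < 1 by norm_num))
  refine tendsto_atTop_mono' _ ?_ tendsto_cbrt_natCast
  filter_upwards [h, eventually_ge_atTop 2] with t ht ht2
  have h1 : (1 : ℝ) < t := by exact_mod_cast ht2
  have h2 : 0 < √(t : ℝ) / Real.log t := div_pos (by positivity) (Real.log_pos h1)
  exact ((div_lt_one h2).1 ht).le

theorem tendsto_cbrt_div_sqrt :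
    Tendsto (fun t : ℕ => (t : ℝ) ^ (1 / 3 : ℝ) / √(t : ℝ)) atTop (𝓝 0) := by
  have h := tendsto_cbrt_mul_log_div_sqrt.mul tendsto_log_natCast.inv_tendsto_atTop
  rw [zero_mul] at h
  refine h.congr' ?_
  filter_upwards [eventually_ge_atTop 2] with t ht
  have h1 : (1 : ℝ) < t := by exact_mod_cast ht
  have h2 := Real.log_pos h1
  have h3 : 0 < √(t : ℝ) := by positivity
  simp only [Pi.inv_apply]
  field_simp

end growth

namespace SweepParams

open Filter Topology

variable {P : SweepParams}

theorem G_pos (hp : P.p₀ < 1) {t : ℕ} (ht : 2 ≤ t) : 0 < P.G t := by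
  have h1 : (1 : ℝ) < t := by exact_mod_cast ht
  have h2 := Real.log_pos h1
  have h3 : 0 < 1 - P.p₀ := by linarith
  exact Nat.ceil_pos.2 (by positivity)

theorem H_pos (hp : P.p₀ < 1) (hB : 0 < P.B) {t : ℕ} (ht : 2 ≤ t) : 0 < P.H t := by
  have h1 : (0 : ℝ) < t := by exact_mod_cast (by omega : 0 < t)
  have h3 : 0 < 1 - P.p₀ := by linarith
  exact Nat.ceil_pos.2 (by positivity)

theorem tendsto_W (hp : P.p₀ < 1) (hA : 0 < P.A) :
    Tendsto (fun t : ℕ => (P.W t : ℝ) / √(t : ℝ)) atTop (𝓝 (P.A / (1 - P.p₀))) := by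
  have h3 : 0 < 1 - P.p₀ := by linarith
  have h := (tendsto_nat_ceil_mul_div_atTop (R := ℝ) (a := P.A / (1 - P.p₀))
    (by positivity)).comp tendsto_sqrt_natCast
  refine h.congr fun t => ?_
  simp only [Function.comp_apply, W]
  ring_nf

theorem tendsto_H (hp : P.p₀ < 1) (hB : 0 < P.B) :
    Tendsto (fun t : ℕ => (P.H t : ℝ) / √(t : ℝ)) atTop (𝓝 (P.B / (1 - P.p₀))) := by
  have h3 : 0 < 1 - P.p₀ := by linarith
  have h := (tendsto_nat_ceil_mul_div_atTop (R := ℝ) (a := P.B / (1 - P.p₀))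
    (by positivity)).comp tendsto_sqrt_natCast
  refine h.congr fun t => ?_
  simp only [Function.comp_apply, H]
  ring_nf

theorem tendsto_G (hp : P.p₀ < 1) :
    Tendsto (fun t : ℕ => (P.G t : ℝ) / (√(t : ℝ) / Real.log t)) atTop
      (𝓝 (1 / (1 - P.p₀))) := by
  have h3 : 0 < 1 - P.p₀ := by linarith
  exact (tendsto_nat_ceil_mul_div_atTop (R := ℝ) (a := 1 / (1 - P.p₀))
    (by positivity)).comp tendsto_sqrt_div_log

theorem tendsto_M_div_G (hp : P.p₀ < 1) :
    Tendsto (fun t : ℕ => (P.M t : ℝ) / P.G t) atTop (𝓝 1) := by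
  have h3 : 0 < 1 - P.p₀ := by linarith
  have h1 : Tendsto (fun t : ℕ => (⌈(t : ℝ) ^ (1 / 3 : ℝ)⌉₊ : ℝ) / (t : ℝ) ^ (1 / 3 : ℝ)) atTop
      (𝓝 1) := (tendsto_nat_ceil_div_atTop (R := ℝ)).comp tendsto_cbrt_natCast
  have h2 := (h1.mul tendsto_cbrt_mul_log_div_sqrt).mul
    ((tendsto_G hp).inv₀ (by positivity))
  have h4 := h2.const_add 1
  simp only [mul_zero, zero_mul, add_zero] at h4
  refine h4.congr' ?_
  filter_upwards [eventually_ge_atTop 2] with t ht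
  have hG : (0 : ℝ) < P.G t := by exact_mod_cast G_pos hp ht
  have h1 : (1 : ℝ) < t := by exact_mod_cast ht
  have h5 := Real.log_pos h1
  have h6 : 0 < √(t : ℝ) := by positivity
  have h7 : 0 < (t : ℝ) ^ (1 / 3 : ℝ) := by positivity
  rw [M]
  push_cast
  field_simp

theorem tendsto_M_div_sqrt (hp : P.p₀ < 1) :
    Tendsto (fun t : ℕ => (P.M t : ℝ) / √(t : ℝ)) atTop (𝓝 0) := by
  have h := ((tendsto_M_div_G hp).mul (tendsto_G hp)).mul tendsto_log_natCast.inv_tendsto_atTop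
  rw [mul_zero] at h
  refine h.congr' ?_
  filter_upwards [eventually_ge_atTop 2] with t ht
  have hG : (0 : ℝ) < P.G t := by exact_mod_cast G_pos hp ht
  have h1 : (1 : ℝ) < t := by exact_mod_cast ht
  have h5 := Real.log_pos h1
  have h6 : 0 < √(t : ℝ) := by positivity
  simp only [Pi.inv_apply]
  field_simp

theorem cbrt_le_M (t : ℕ) : (t : ℝ) ^ (1 / 3 : ℝ) ≤ (P.M t : ℝ) - P.G t := by
  have := Nat.le_ceil ((t : ℝ) ^ (1 / 3 : ℝ))
  rw [M]
  push_cast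
  linarith

/-- The ratio 2H/G grows like 2B ln t. This logarithm makes the vertical steps negligible among the
horizontal ones. -/
theorem tendsto_N (hp : P.p₀ < 1) (hB : 0 < P.B) :
    Tendsto (fun t : ℕ => (P.N t : ℝ)) atTop atTop := by
  have h3 : 0 < 1 - P.p₀ := by linarith
  have h := Tendsto.pos_mul_atTop (C := P.B / (1 - P.p₀) * (1 / (1 - P.p₀))⁻¹) (by positivity)
    ((tendsto_H hp hB).mul ((tendsto_G hp).inv₀ (by positivity))) tendsto_log_natCast
  refine tendsto_atTop_mono' _ ?_ h
  filter_upwards [eventually_ge_atTop 2] with t ht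
  have hG : (0 : ℝ) < P.G t := by exact_mod_cast G_pos hp ht
  have h1 : (1 : ℝ) < t := by exact_mod_cast ht
  have h5 := Real.log_pos h1
  have h6 : 0 < √(t : ℝ) := by positivity
  have h7 : (2 * P.H t : ℝ) / P.G t ≤ P.N t := Nat.le_ceil _
  refine le_trans ?_ h7
  have e : (P.H t : ℝ) / √(t : ℝ) * (P.G t / (√(t : ℝ) / Real.log t))⁻¹ * Real.log t
      = P.H t / P.G t := by field_simp
  rw [e]
  gcongr
  linarith [(Nat.cast_nonneg (P.H t) : (0 : ℝ) ≤ _)]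

theorem N_sub_one_mul_G_le (hp : P.p₀ < 1) {t : ℕ} (ht : 2 ≤ t) :
    ((P.N t : ℝ) - 1) * P.G t ≤ 2 * P.H t := by
  have hG : (0 : ℝ) < P.G t := by exact_mod_cast G_pos hp ht
  have h := Nat.ceil_lt_add_one (show (0 : ℝ) ≤ (2 * P.H t : ℝ) / P.G t by positivity)
  rw [← N] at h
  rw [← le_div_iff₀ hG]
  linarith

/-- The duration of a phase that starts at time `t`. -/
noncomputable def duration (P : SweepParams) (t : ℕ) : ℕ := (P.phase t 0).length

theorem duration_eq (hp : P.p₀ < 1) (hB : 0 < P.B) {t : ℕ} (ht : 2 ≤ t) :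
    (P.duration t : ℝ) = 2 * P.W t * (P.N t + 1) +
      (2 * ((P.N t - 1) * P.G t) + 2 * P.M t) :=
  length_phase (G_pos hp ht) (H_pos hp hB ht) (Nat.zero_le _)

theorem length_phase_eq_duration (hp : P.p₀ < 1) (hB : 0 < P.B) {t z : ℕ} (ht : 2 ≤ t)
    (hz : z ≤ P.M t) : (P.phase t z).length = P.duration t := by
  have h1 := length_phase (G_pos hp ht) (H_pos hp hB ht) hz
  rw [← duration_eq hp hB ht] at h1
  exact_mod_cast h1

/-- The main term is 2W·(2H/G)·M with M/G → 1, the area of the swept box; every other term has a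
spare factor M/√t → 0. -/
theorem eventually_duration_mul_M_le (hp : P.p₀ < 1) (hA : 0 < P.A) (hB : 0 < P.B) {q : ℝ}
    (hq : 4 * (P.A / (1 - P.p₀)) * (P.B / (1 - P.p₀)) < q) :
    ∀ᶠ t : ℕ in atTop, (P.duration t : ℝ) * P.M t ≤ q * t := by
  have hW := tendsto_W hp hA
  have hH := tendsto_H hp hB
  have hM := tendsto_M_div_sqrt hp
  have h := (((((hW.const_mul 4).mul hH).mul (tendsto_M_div_G hp)).add
    ((hW.const_mul 4).mul hM)).add ((hH.const_mul 4).mul hM)).add ((hM.const_mul 2).mul hM)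
  simp only [mul_one, mul_zero, add_zero] at h
  filter_upwards [h.eventually (gt_mem_nhds hq), eventually_ge_atTop 2] with t ht ht2
  have hG : (0 : ℝ) < P.G t := by exact_mod_cast G_pos hp ht2
  have ht0 : (0 : ℝ) < t := by exact_mod_cast (by omega : 0 < t)
  have h6 : 0 < √(t : ℝ) := by positivity
  have hs : √(t : ℝ) * √(t : ℝ) = t := Real.mul_self_sqrt ht0.le
  have hN := N_sub_one_mul_G_le hp ht2
  have hN' : (P.N t : ℝ) + 1 ≤ 2 * P.H t / P.G t + 2 := by
    rw [← le_div_iff₀ hG] at hN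
    linarith
  have hD : (P.duration t : ℝ) ≤ 2 * P.W t * (2 * P.H t / P.G t + 2) +
      (2 * (2 * P.H t) + 2 * P.M t) := by
    rw [duration_eq hp hB ht2]
    gcongr
  refine le_trans (mul_le_mul_of_nonneg_right hD (Nat.cast_nonneg _)) ?_
  have e : (2 * P.W t * (2 * P.H t / P.G t + 2) + (2 * (2 * P.H t) + 2 * P.M t)) * (P.M t : ℝ)
      = (4 * (P.W t / √(t : ℝ)) * (P.H t / √(t : ℝ)) * (P.M t / P.G t)
        + 4 * (P.W t / √(t : ℝ)) * (P.M t / √(t : ℝ)) + 4 * (P.H t / √(t : ℝ)) * (P.M t / √(t : ℝ))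
        + 2 * (P.M t / √(t : ℝ)) * (P.M t / √(t : ℝ))) * (√(t : ℝ) * √(t : ℝ)) := by
    field_simp
    ring
  rw [e, hs]
  exact mul_le_mul_of_nonneg_right ht.le ht0.le

/-- Divide L·G ≤ L·M ≤ q t by G, which is much larger than t^(1/3). This makes the Chebyshev error
for fluctuations of order t^(1/3) small. -/
theorem eventually_duration_le_sq_cbrt (hp : P.p₀ < 1) (hA : 0 < P.A) (hB : 0 < P.B) {ε : ℝ}
    (hε : 0 < ε) :
    ∀ᶠ t : ℕ in atTop, (P.duration t : ℝ) ≤ ε * ((t : ℝ) ^ (1 / 3 : ℝ)) ^ 2 := by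
  have h3 : 0 < 1 - P.p₀ := by linarith
  set q := 4 * (P.A / (1 - P.p₀)) * (P.B / (1 - P.p₀)) + 1 with hq
  have hq0 : 0 < q := by positivity
  have hGc : Tendsto (fun t : ℕ => (t : ℝ) ^ (1 / 3 : ℝ) / P.G t) atTop (𝓝 0) := by
    have h := tendsto_cbrt_mul_log_div_sqrt.mul ((tendsto_G hp).inv₀ (by positivity))
    rw [zero_mul] at h
    refine h.congr' ?_
    filter_upwards [eventually_ge_atTop 2] with t ht
    have hG : (0 : ℝ) < P.G t := by exact_mod_cast G_pos hp ht
    have h1 : (1 : ℝ) < t := by exact_mod_cast ht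
    have h5 := Real.log_pos h1
    have h6 : 0 < √(t : ℝ) := by positivity
    field_simp
  filter_upwards [eventually_duration_mul_M_le hp hA hB (lt_add_one _),
    hGc.eventually (gt_mem_nhds (show 0 < ε / q by positivity)), eventually_ge_atTop 2]
    with t h1 h2 ht
  have hG : (0 : ℝ) < P.G t := by exact_mod_cast G_pos hp ht
  have ht0 : (0 : ℝ) < t := by exact_mod_cast (by omega : 0 < t)
  set x := (t : ℝ) ^ (1 / 3 : ℝ) with hx
  have hx0 : 0 < x := by positivity
  have hx3 : (t : ℝ) = x ^ 3 := by
    rw [hx, ← Real.rpow_natCast, ← Real.rpow_mul ht0.le]; norm_num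
  have hGM : (P.G t : ℝ) ≤ P.M t := by exact_mod_cast Nat.le_add_right _ _
  rw [div_lt_div_iff₀ hG hq0] at h2
  have h4 : (P.duration t : ℝ) * P.G t ≤ ε * x ^ 2 * P.G t := by
    calc (P.duration t : ℝ) * P.G t ≤ P.duration t * P.M t := by gcongr
      _ ≤ q * t := h1
      _ = x * q * x ^ 2 := by rw [hx3]; ring
      _ ≤ ε * P.G t * x ^ 2 := by gcongr
      _ = _ := by ring
  exact le_of_mul_le_mul_right h4 hG

theorem eventually_duration_le (hp : P.p₀ < 1) (hA : 0 < P.A) (hB : 0 < P.B) {ε : ℝ}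
    (hε : 0 < ε) : ∀ᶠ t : ℕ in atTop, (P.duration t : ℝ) ≤ ε * t := by
  filter_upwards [eventually_duration_le_sq_cbrt hp hA hB hε, eventually_ge_atTop 1] with t h ht
  have ht1 : (1 : ℝ) ≤ t := by exact_mod_cast ht
  refine h.trans (mul_le_mul_of_nonneg_left ?_ hε.le)
  rw [← Real.rpow_natCast, ← Real.rpow_mul (by positivity)]
  calc (t : ℝ) ^ (1 / 3 * ((2 : ℕ) : ℝ)) ≤ (t : ℝ) ^ (1 : ℝ) :=
        Real.rpow_le_rpow_of_exponent_le ht1 (by norm_num)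
    _ = t := Real.rpow_one _

/-- The vertical steps are a negligible part of a phase. -/
theorem eventually_vertical_le (hp : P.p₀ < 1) (hA : 0 < P.A) (hB : 0 < P.B) {ε : ℝ}
    (hε : 0 < ε) : ∀ᶠ t : ℕ in atTop,
      2 * (((P.N t : ℝ) - 1) * P.G t) + 2 * P.M t ≤ ε * P.duration t := by
  have h3 : 0 < 1 - P.p₀ := by linarith
  have hAp : 0 < P.A / (1 - P.p₀) := by positivity
  set C := P.B / (1 - P.p₀) + 1 with hC
  have hC0 : 0 < C := by positivity
  filter_upwards [(tendsto_W hp hA).eventually (lt_mem_nhds (half_lt_self hAp)),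
    (tendsto_H hp hB).eventually (gt_mem_nhds (lt_add_one _)),
    (tendsto_M_div_sqrt hp).eventually (gt_mem_nhds hC0),
    (tendsto_N hp hB).eventually_ge_atTop (6 * C / (ε * (P.A / (1 - P.p₀)))),
    eventually_ge_atTop 2] with t hW hH hM hN ht
  have ht0 : (0 : ℝ) < t := by exact_mod_cast (by omega : 0 < t)
  have h6 : 0 < √(t : ℝ) := by positivity
  have h7 := N_sub_one_mul_G_le hp ht
  have hG : (0 : ℝ) < P.G t := by exact_mod_cast G_pos hp ht
  have hNpos : (1 : ℝ) ≤ P.N t := by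
    exact_mod_cast N_pos (G_pos hp ht) (H_pos hp hB ht)
  have hv : 0 ≤ ((P.N t : ℝ) - 1) * P.G t := mul_nonneg (by linarith) hG.le
  rw [lt_div_iff₀ h6] at hW
  rw [div_lt_iff₀ h6] at hH hM
  rw [div_le_iff₀ (by positivity)] at hN
  rw [duration_eq hp hB ht]
  calc 2 * (((P.N t : ℝ) - 1) * P.G t) + 2 * P.M t ≤ 4 * (C * √t) + 2 * (C * √t) := by linarith
    _ = 6 * C * √t := by ring
    _ ≤ P.N t * (ε * (P.A / (1 - P.p₀))) * √t := by gcongr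
    _ = ε * (2 * (P.A / (1 - P.p₀) / 2 * √t) * P.N t) := by ring
    _ ≤ ε * (2 * P.W t * P.N t) := by gcongr
    _ ≤ _ := by
      gcongr
      have : (0 : ℝ) ≤ P.W t := Nat.cast_nonneg _
      have : (0 : ℝ) ≤ P.M t := Nat.cast_nonneg _
      linarith

/-- The swept box leaves a margin around the box with half-widths `A √t` and `B √t`. -/
theorem eventually_margin {p a K κ : ℝ} (hp : p < P.p₀) (hp0 : P.p₀ < 1) (ha : 0 < a) :
    ∀ᶠ t : ℕ in atTop, a * √(t : ℝ) + K + κ * (t : ℝ) ^ (1 / 3 : ℝ) <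
      (1 - p) * (1 / (1 - P.p₀) * (a * √(t : ℝ))) := by
  have h3 : 0 < 1 - P.p₀ := by linarith
  have h1 : Tendsto (fun t : ℕ => K / √(t : ℝ) + κ * ((t : ℝ) ^ (1 / 3 : ℝ) / √(t : ℝ))) atTop
      (𝓝 (0 + κ * 0)) :=
    (tendsto_sqrt_natCast.const_div_atTop K).add (tendsto_cbrt_div_sqrt.const_mul κ)
  rw [mul_zero, add_zero] at h1
  have h4 : 0 < a * ((1 - p) / (1 - P.p₀) - 1) :=
    mul_pos ha (by rw [sub_pos, one_lt_div h3]; linarith)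
  filter_upwards [h1.eventually (gt_mem_nhds h4), eventually_ge_atTop 1] with t ht ht1
  have ht0 : (0 : ℝ) < t := by exact_mod_cast (by omega : 0 < t)
  have h6 : 0 < √(t : ℝ) := by positivity
  have h7 := mul_lt_mul_of_pos_right ht h6
  have e1 : (K / √(t : ℝ) + κ * ((t : ℝ) ^ (1 / 3 : ℝ) / √(t : ℝ))) * √(t : ℝ)
      = K + κ * (t : ℝ) ^ (1 / 3 : ℝ) := by field_simp
  rw [e1] at h7
  have e2 : (1 - p) * (1 / (1 - P.p₀) * (a * √(t : ℝ)))
      = a * ((1 - p) / (1 - P.p₀) - 1) * √(t : ℝ) + a * √(t : ℝ) := by ring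
  rw [e2]
  linarith

end SweepParams

/-! ### A Lyapunov argument for polynomial decay -/

/-- Convexity is applied between y - κ and 0. Because of this shift, bounds exp(κ) m on the mean of
exp(y) and m on the mass give exactly exp(θκ) m, with no constant lost over infinitely many phases.
-/
theorem exp_smul_le_of_convex {θ y κ : ℝ} (h0 : 0 ≤ θ) (h1 : θ ≤ 1) :
    Real.exp (θ * y) ≤ Real.exp (θ * κ) * (θ * (Real.exp (-κ) * Real.exp y) + (1 - θ)) := by
  have h := convexOn_exp.2 (Set.mem_univ (y - κ)) (Set.mem_univ 0) h0
    (show (0 : ℝ) ≤ 1 - θ by linarith) (by ring)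
  simp only [smul_eq_mul, mul_zero, add_zero, Real.exp_zero, mul_one] at h
  have e1 : Real.exp (θ * y) = Real.exp (θ * κ) * Real.exp (θ * (y - κ)) := by
    rw [← Real.exp_add]; ring_nf
  have e2 : Real.exp (-κ) * Real.exp y = Real.exp (y - κ) := by
    rw [← Real.exp_add]; ring_nf
  rw [e1, e2]
  exact mul_le_mul_of_nonneg_left h (Real.exp_pos _).le

theorem rpow_neg_mul_exp_le {T L h : ℝ} (hT : 0 < T) (hL : 0 ≤ L) (hh : 0 ≤ h) :
    T ^ (-h) * Real.exp (-(h * L / T)) ≤ (T + L) ^ (-h) := by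
  have e : T + L = T * (1 + L / T) := by field_simp
  have h1 : 0 ≤ L / T := by positivity
  rw [e, Real.mul_rpow hT.le (by positivity)]
  refine mul_le_mul_of_nonneg_left ?_ (by positivity)
  rw [Real.rpow_def_of_pos (by positivity), Real.exp_le_exp]
  have h2 : Real.log (1 + L / T) ≤ L / T := by
    have := Real.log_le_sub_one_of_pos (show 0 < 1 + L / T by positivity)
    linarith
  have h3 := mul_le_mul_of_nonneg_right h2 hh
  have e3 : h * L / T = L / T * h := by ring
  rw [e3]
  linarith

open Filter in
/-- Suppose that the positive functionals `Λ i` describe a killed process at the times `T i`, that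
exponential moments grow at most as for a random walk with variance one, and that the killing rate
outweighs the growth of `T`, up to an error controlled by exponential moments. Then the mass decays
faster than `T ^ (-h)`. -/
theorem exists_mass_le_rpow {E ι : Type*} [Fintype ι] {Λ : ℕ → (E → ℝ) →ₗ[ℝ] ℝ}
    (hmono : ∀ i f g, f ≤ g → Λ i f ≤ Λ i g) {T L : ℕ → ℝ} (hT : ∀ i, 1 ≤ T i)
    (hL : ∀ i, 0 ≤ L i) (hTL : ∀ i, T (i + 1) = T i + L i) {φ : ι → E → ℝ} {α b h h' : ℝ}
    (hh : 0 < h) (hhh' : h < h')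
    (hsmall : ∀ᶠ i in atTop, L i ≤ (h' / h - 1) * T i)
    (hexp : ∀ᶠ i in atTop, ∀ k, Λ (i + 1) (fun x => Real.exp (α / √(T (i + 1)) * φ k x)) ≤
      Real.exp (α ^ 2 / (2 * T (i + 1)) * L i) *
        Λ i (fun x => Real.exp (α / √(T (i + 1)) * φ k x)))
    (hmass : ∀ᶠ i in atTop, ∃ ρ, 0 ≤ ρ ∧ ρ ≤ 1 ∧
      h * L i ≤ ρ * (1 - Fintype.card ι * Real.exp (2 * h' + α ^ 2 - b)) * T i ∧
      Λ (i + 1) (fun _ => 1) ≤ (1 - ρ) * Λ i (fun _ => 1) +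
        ρ * (Real.exp (-b) * ∑ k, Λ i (fun x => Real.exp (α / √(T i) * φ k x)))) :
    ∃ C, ∀ᶠ i in atTop, Λ i (fun _ => 1) ≤ C * T i ^ (-h) := by
  obtain ⟨i₀, hi₀⟩ := eventually_atTop.1 (hsmall.and (hexp.and hmass))
  -- In one phase the exponent gains α²L/(2T) from the variance and loses at least κL/(2T) from the
  -- smaller rate α/√T. The net loss must be at least hL/T, so κ ≥ 2h + α²; taking h' > h absorbs
  -- the difference between `T i` and `T (i + 1)`.
  set κ := 2 * h' + α ^ 2 with hκ
  set C := Λ i₀ (fun _ => 1) * T i₀ ^ h +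
    ∑ k, Λ i₀ (fun x => Real.exp (α / √(T i₀) * φ k x)) * T i₀ ^ h with hC
  have hTpos : ∀ i, 0 < T i := fun i => lt_of_lt_of_le one_pos (hT i)
  have hnn : ∀ i f, 0 ≤ f → 0 ≤ Λ i f := fun i f hf => by
    simpa using hmono i 0 f hf
  have h1nn : ∀ i, 0 ≤ Λ i (fun _ => 1) := fun i => hnn _ _ fun _ => zero_le_one
  have henn : ∀ i k, 0 ≤ Λ i (fun x => Real.exp (α / √(T i) * φ k x)) := fun i k =>
    hnn _ _ fun _ => (Real.exp_pos _).le
  have hC0 : 0 ≤ C := add_nonneg (mul_nonneg (h1nn _) (Real.rpow_nonneg (hTpos _).le _))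
    (Finset.sum_nonneg fun k _ => mul_nonneg (henn _ _) (Real.rpow_nonneg (hTpos _).le _))
  have hκ0 : 0 ≤ κ := by
    have : 0 ≤ α ^ 2 := sq_nonneg _
    linarith
  -- The moments bound the mass outside the box, and the mass enters the convexity step, so both
  -- bounds are propagated together. The moments are compared with C T^(-h), not with the actual
  -- mass, for which no lower bound is available.
  have key : ∀ n, Λ (i₀ + n) (fun _ => 1) ≤ C * T (i₀ + n) ^ (-h) ∧
      ∀ k, Λ (i₀ + n) (fun x => Real.exp (α / √(T (i₀ + n)) * φ k x)) ≤
        Real.exp κ * (C * T (i₀ + n) ^ (-h)) := by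
    intro n
    induction n with
    | zero =>
      have hTT : T i₀ ^ h * T i₀ ^ (-h) = 1 := by
        rw [← Real.rpow_add (hTpos _), add_neg_cancel, Real.rpow_zero]
      have hTn : 0 ≤ T i₀ ^ (-h) := Real.rpow_nonneg (hTpos _).le _
      have hTn' : 0 ≤ T i₀ ^ h := Real.rpow_nonneg (hTpos _).le _
      have hsum : ∀ k, Λ i₀ (fun x => Real.exp (α / √(T i₀) * φ k x)) * T i₀ ^ h ≤
          ∑ k, Λ i₀ (fun x => Real.exp (α / √(T i₀) * φ k x)) * T i₀ ^ h := fun k =>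
        Finset.single_le_sum (f := fun k => Λ i₀ (fun x => Real.exp (α / √(T i₀) * φ k x)) *
          T i₀ ^ h) (fun k _ => mul_nonneg (henn _ _) hTn') (Finset.mem_univ k)
      have hsum0 : 0 ≤ ∑ k, Λ i₀ (fun x => Real.exp (α / √(T i₀) * φ k x)) * T i₀ ^ h :=
        Finset.sum_nonneg fun k _ => mul_nonneg (henn _ _) hTn'
      have haux : ∀ m : ℝ, m * T i₀ ^ h ≤ C → m ≤ C * T i₀ ^ (-h) := fun m hm => by
        calc m = m * T i₀ ^ h * T i₀ ^ (-h) := by rw [mul_assoc, hTT, mul_one]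
          _ ≤ _ := mul_le_mul_of_nonneg_right hm hTn
      have h1' := mul_nonneg (h1nn i₀) hTn'
      rw [add_zero]
      refine ⟨haux _ (by linarith), fun k => ?_⟩
      refine (haux _ (by linarith [hsum k])).trans ?_
      exact le_mul_of_one_le_left (mul_nonneg hC0 hTn) (Real.one_le_exp hκ0)
    | succ n ih =>
      rw [← add_assoc]
      set i := i₀ + n with hi
      obtain ⟨ih1, ih2⟩ := ih
      obtain ⟨hs, he, ρ, hρ0, hρ1, hρ, hm⟩ := hi₀ i (by omega)
      have hTi := hTpos i
      have hTi' := hTpos (i + 1)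
      have hgrow := rpow_neg_mul_exp_le hTi (hL i) hh.le
      rw [← hTL] at hgrow
      set m := C * T i ^ (-h) with hmdef
      have hm0 : 0 ≤ m := mul_nonneg hC0 (Real.rpow_nonneg hTi.le _)
      have hgrow' : m * Real.exp (-(h * L i / T i)) ≤ C * T (i + 1) ^ (-h) := by
        rw [hmdef, mul_assoc]
        exact mul_le_mul_of_nonneg_left hgrow hC0
      constructor
      · refine le_trans ?_ hgrow'
        have h2 : Real.exp (-b) * ∑ k, Λ i (fun x => Real.exp (α / √(T i) * φ k x)) ≤
            Fintype.card ι * Real.exp (κ - b) * m := by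
          calc _ ≤ Real.exp (-b) * ∑ _k : ι, Real.exp κ * m := by
                gcongr with k
                exact ih2 k
            _ = _ := by
                rw [Finset.sum_const, Finset.card_univ, nsmul_eq_mul, sub_eq_add_neg,
                  Real.exp_add κ]
                ring
        calc _ ≤ (1 - ρ) * m + ρ * (Fintype.card ι * Real.exp (κ - b) * m) := by
              refine hm.trans (add_le_add ?_ ?_)
              · exact mul_le_mul_of_nonneg_left ih1 (by linarith)
              · exact mul_le_mul_of_nonneg_left h2 hρ0
          _ = m * (1 - ρ * (1 - Fintype.card ι * Real.exp (κ - b))) := by ring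
          _ ≤ m * Real.exp (-(h * L i / T i)) := by
              refine mul_le_mul_of_nonneg_left ?_ hm0
              refine le_trans ?_ (Real.add_one_le_exp _)
              have h3 : h * L i / T i ≤ ρ * (1 - Fintype.card ι * Real.exp (κ - b)) := by
                rw [div_le_iff₀ hTi]
                exact hρ
              linarith
      · intro k
        refine le_trans ?_ (mul_le_mul_of_nonneg_left hgrow' (Real.exp_pos κ).le)
        set θ := √(T i) / √(T (i + 1)) with hθ
        have hsq : 0 < √(T i) := Real.sqrt_pos.2 hTi
        have hsq' : 0 < √(T (i + 1)) := Real.sqrt_pos.2 hTi'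
        have hθ0 : 0 ≤ θ := by positivity
        have hθsq : θ ^ 2 = 1 - L i / T (i + 1) := by
          rw [hθ, div_pow, Real.sq_sqrt hTi.le, Real.sq_sqrt hTi'.le, hTL]
          have : T i + L i ≠ 0 := by rw [← hTL]; exact hTi'.ne'
          field_simp
          ring
        have hLT : 0 ≤ L i / T (i + 1) := div_nonneg (hL i) hTi'.le
        have hθ1 : θ ≤ 1 - L i / (2 * T (i + 1)) := by
          have e : L i / (2 * T (i + 1)) = L i / T (i + 1) / 2 := by
            field_simp
          rw [e]
          nlinarith [sq_nonneg (1 - θ)]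
        have hθ1' : θ ≤ 1 := by
          have : 0 ≤ L i / (2 * T (i + 1)) := div_nonneg (hL i) (by positivity)
          linarith
        have hE : Λ i (fun x => Real.exp (α / √(T (i + 1)) * φ k x)) ≤ Real.exp (θ * κ) * m := by
          have h4 : (fun x => Real.exp (α / √(T (i + 1)) * φ k x)) ≤
              Real.exp (θ * κ) • ((θ * Real.exp (-κ)) • (fun x => Real.exp (α / √(T i) * φ k x)) +
                (1 - θ) • (fun _ => (1 : ℝ))) := by
            intro x
            have e : α / √(T (i + 1)) * φ k x = θ * (α / √(T i) * φ k x) := by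
              rw [hθ]; field_simp
            simp only [e]
            simpa [mul_assoc] using exp_smul_le_of_convex (y := α / √(T i) * φ k x) (κ := κ)
              hθ0 hθ1'
          refine (hmono i _ _ h4).trans ?_
          rw [map_smul, map_add, map_smul, map_smul]
          simp only [smul_eq_mul]
          refine mul_le_mul_of_nonneg_left ?_ (Real.exp_pos _).le
          calc _ ≤ θ * Real.exp (-κ) * (Real.exp κ * m) + (1 - θ) * m := by
                refine add_le_add ?_ ?_
                · exact mul_le_mul_of_nonneg_left (ih2 k) (by positivity)
                · exact mul_le_mul_of_nonneg_left ih1 (by linarith)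
            _ = θ * (Real.exp (-κ) * Real.exp κ) * m + (1 - θ) * m := by ring
            _ = m := by rw [← Real.exp_add, neg_add_cancel, Real.exp_zero]; ring
        calc _ ≤ Real.exp (α ^ 2 / (2 * T (i + 1)) * L i) * (Real.exp (θ * κ) * m) :=
              (he k).trans (mul_le_mul_of_nonneg_left hE (Real.exp_pos _).le)
          _ = Real.exp (α ^ 2 / (2 * T (i + 1)) * L i + θ * κ) * m := by
              rw [Real.exp_add]; ring
          _ ≤ Real.exp (κ + -(h * L i / T i)) * m := by
              refine mul_le_mul_of_nonneg_right (Real.exp_le_exp.2 ?_) hm0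
              have h5 : h * L i / T i ≤ h' * L i / T (i + 1) := by
                rw [div_le_div_iff₀ hTi hTi', hTL]
                have h6 : h * (T i + L i) ≤ h' * T i := by
                  have h7 := mul_le_mul_of_nonneg_left hs hh.le
                  have e : h * ((h' / h - 1) * T i) = h' * T i - h * T i := by field_simp
                  rw [e] at h7
                  linarith
                nlinarith [mul_le_mul_of_nonneg_right h6 (hL i)]
              have h8 := mul_le_mul_of_nonneg_right hθ1 hκ0
              have e9 : (1 - L i / (2 * T (i + 1))) * κ
                  = κ - h' * L i / T (i + 1) - α ^ 2 / (2 * T (i + 1)) * L i := by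
                rw [hκ]; field_simp; ring
              rw [e9] at h8
              linarith
          _ = _ := by rw [Real.exp_add]; ring
  refine ⟨C, eventually_atTop.2 ⟨i₀, fun i hi => ?_⟩⟩
  have := (key (i - i₀)).1
  rwa [Nat.add_sub_cancel' hi] at this

namespace SweepParams

open Filter Topology

/-! ### One phase of the sweeping strategy -/

/-- The survival operator of a phase that starts at time `t`, averaged over its offset. -/
noncomputable def phaseOp (P : SweepParams) (p : ℝ) (home : ℤ × ℤ) (t : ℕ) :
    (ℤ × ℤ → ℝ) →ₗ[ℝ] (ℤ × ℤ → ℝ) :=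
  (P.M t : ℝ)⁻¹ • ∑ z ∈ Finset.Icc 1 (P.M t), survOp p home (P.phase t z)

variable {P : SweepParams} {p : ℝ} {home : ℤ × ℤ}

theorem phaseOp_apply (t : ℕ) (f : ℤ × ℤ → ℝ) (x : ℤ × ℤ) : P.phaseOp p home t f x =
    (P.M t : ℝ)⁻¹ * ∑ z ∈ Finset.Icc 1 (P.M t), survOp p home (P.phase t z) f x := by
  simp [phaseOp, LinearMap.smul_apply, LinearMap.sum_apply]

theorem phaseOp_mono (hp : p ∈ Set.Icc (0 : ℝ) 1) (t : ℕ) {f g : ℤ × ℤ → ℝ} (h : f ≤ g) :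
    P.phaseOp p home t f ≤ P.phaseOp p home t g := fun x => by
  rw [phaseOp_apply, phaseOp_apply]
  exact mul_le_mul_of_nonneg_left (Finset.sum_le_sum fun z _ => survOp_mono hp _ h x)
    (by positivity)

theorem phaseOp_le_of_forall {t : ℕ} (ht : 1 ≤ t) {f : ℤ × ℤ → ℝ} {x : ℤ × ℤ} {K : ℝ}
    (h : ∀ z ∈ Finset.Icc 1 (P.M t), survOp p home (P.phase t z) f x ≤ K) :
    P.phaseOp p home t f x ≤ K := by
  have hM : (0 : ℝ) < P.M t := by exact_mod_cast P.one_le_M ht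
  rw [phaseOp_apply, inv_mul_le_iff₀ hM]
  refine (Finset.sum_le_sum h).trans_eq ?_
  simp

theorem phaseOp_one_le_one (hp : p ∈ Set.Icc (0 : ℝ) 1) {t : ℕ} (ht : 1 ≤ t) (x : ℤ × ℤ) :
    P.phaseOp p home t (fun _ => 1) x ≤ 1 := by
  refine phaseOp_le_of_forall ht fun z _ => ?_
  rw [survOp_apply]
  refine (stepsExp_mono hp _ fun a => ?_).trans_eq (stepsExp_const _ 1)
  simpa using aliveInd_le_one x a

/-- An agent that starts a late phase in the box finds its home with probability close to `1 / M`. -/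
theorem eventually_phaseOp_one_le (hp0 : 0 ≤ p) (hp : p < P.p₀) (hP : P.p₀ < 1) (hA : 0 < P.A)
    (hB : 0 < P.B) (home : ℤ × ℤ) {ε : ℝ} (hε : 0 < ε) :
    ∀ᶠ t : ℕ in atTop, ∀ x : ℤ × ℤ, |(x.1 : ℝ)| ≤ P.A * √(t : ℝ) → |(x.2 : ℝ)| ≤ P.B * √(t : ℝ) →
      P.phaseOp p home t (fun _ => 1) x ≤ 1 - (1 - ε) / P.M t := by
  have hq : 0 < 1 - P.p₀ := by linarith
  -- With δ = κ t^(1/3), the term 6δ takes half of the room (1-p₀) t^(1/3) provided by `M - G`; the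
  -- other half exceeds 2 for large t. The duration bound then makes 8L/δ² at most ε.
  set κ := (1 - P.p₀) / 12 with hκ
  have hκ0 : 0 < κ := by positivity
  filter_upwards [eventually_duration_le_sq_cbrt hP hA hB (ε := ε * κ ^ 2 / 8) (by positivity),
    eventually_margin (K := |(home.1 : ℝ)|) (κ := 3 * κ) hp hP hA,
    eventually_margin (K := |(home.2 : ℝ)| + 1) (κ := 3 * κ) hp hP hB,
    tendsto_cbrt_natCast.eventually_ge_atTop (4 / (1 - P.p₀)), eventually_ge_atTop 2]
    with t hD hW hH hc ht x hx1 hx2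
  have ht0 : (0 : ℝ) < t := by exact_mod_cast (by omega : 0 < t)
  have hG := G_pos hP ht
  have hHpos := H_pos hP hB ht
  have hMpos : (0 : ℝ) < P.M t := by exact_mod_cast P.one_le_M (by omega : 1 ≤ t)
  set y := (t : ℝ) ^ (1 / 3 : ℝ) with hy
  have hy0 : 0 < y := by positivity
  choose post hpost using fun z => P.phase_eq t z
  have hWle : 1 / (1 - P.p₀) * (P.A * √(t : ℝ)) ≤ P.W t := Nat.le_ceil _
  have hHle : 1 / (1 - P.p₀) * (P.B * √(t : ℝ)) ≤ P.H t := Nat.le_ceil _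
  have h1p : 0 < 1 - p := by linarith
  have hWle' := mul_le_mul_of_nonneg_left hWle h1p.le
  have hHle' := mul_le_mul_of_nonneg_left hHle h1p.le
  have hNG : (2 * P.H t : ℝ) ≤ P.N t * P.G t := by exact_mod_cast two_H_le hG
  have hNG' := mul_le_mul_of_nonneg_left hNG h1p.le
  have hx1' := abs_le.1 hx1
  have hx2' := abs_le.1 hx2
  have hh1 := abs_le.1 (le_refl |(home.1 : ℝ)|)
  have hh2 := abs_le.1 (le_refl |(home.2 : ℝ)|)
  have key := sum_hitting_ge (home := home) (x := x) hp0 (hp.trans hP) (δ := κ * y) (W := P.W t)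
    (H := P.H t) (G := P.G t) (N := P.N t) (M := P.M t) (by positivity) hG
    (by
      have h1 := P.cbrt_le_M t
      have h2 := mul_le_mul_of_nonneg_left h1 h1p.le
      rw [div_le_iff₀ hq] at hc
      have h3 : (1 - P.p₀) * y ≤ (1 - p) * y := by gcongr
      have h4 : 6 * (κ * y) = (1 - P.p₀) * y / 2 := by rw [hκ]; ring
      rw [h4]
      linarith)
    (by
      have : |((home - x).1 : ℝ)| ≤ |(home.1 : ℝ)| + P.A * √(t : ℝ) := by
        push_cast [Prod.fst_sub]
        exact (abs_sub _ _).trans (by linarith)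
      linarith)
    (by push_cast [Prod.snd_sub]; linarith)
    (by push_cast [Prod.snd_sub]; nlinarith) post
  simp only [← hpost] at key
  have hlen : (P.W t + P.H t + P.M t + (sweepLines (P.W t) (P.G t) (P.N t) true).length : ℝ)
      ≤ P.duration t := by
    rw [← length_phase_eq_duration hP hB ht le_rfl, hpost (P.M t)]
    simp only [List.length_append, List.length_replicate]
    push_cast
    linarith [(Nat.cast_nonneg (post (P.M t)).length : (0 : ℝ) ≤ _)]
  have herr : 8 * (P.W t + P.H t + P.M t + (sweepLines (P.W t) (P.G t) (P.N t) true).length : ℝ)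
      / (κ * y) ^ 2 ≤ ε := by
    rw [div_le_iff₀ (by positivity)]
    have := hlen.trans hD
    calc _ ≤ 8 * (ε * κ ^ 2 / 8 * y ^ 2) := by linarith
      _ = _ := by ring
  rw [Finset.sum_sub_distrib, Finset.sum_const, Nat.card_Icc, Nat.add_sub_cancel, nsmul_eq_mul,
    mul_one] at key
  rw [phaseOp_apply, inv_mul_le_iff₀ hMpos, mul_sub, mul_one, mul_div_cancel₀ _ hMpos.ne']
  change _ ≤ (P.M t : ℝ) - (1 - ε)
  have e : (1 : ℤ × ℤ → ℝ) = fun _ => 1 := rfl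
  rw [e] at key
  linarith

/-- Exponential moments of a coordinate grow during a late phase at most as those of a Gaussian
with variance `s` per time step. -/
theorem exists_eventually_phaseOp_exp_le (hp : p ∈ Set.Icc (0 : ℝ) 1) (hP : P.p₀ < 1)
    (hB : 0 < P.B) {c : ℤ × ℤ →+ ℝ} (hc : IsCoordinate c) {vh vv s : ℝ}
    (hvh : p / 2 + p * (1 - p) * c (1, 0) ^ 2 < vh)
    (hvv : p / 2 + p * (1 - p) * c (0, 1) ^ 2 < vv)
    (hs : ∀ᶠ t : ℕ in atTop, (2 * P.W t * (P.N t + 1)) * vh +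
      (2 * ((P.N t - 1) * P.G t) + 2 * P.M t) * vv ≤ s * P.duration t) (home : ℤ × ℤ) :
    ∃ r₀ > 0, ∀ᶠ t : ℕ in atTop, ∀ r : ℝ, |r| ≤ r₀ → ∀ x,
      P.phaseOp p home t (fun y => Real.exp (r * c y)) x ≤
        Real.exp (r ^ 2 / 2 * (s * P.duration t)) * Real.exp (r * c x) := by
  have hneg1 : c (-1, 0) ^ 2 = c (1, 0) ^ 2 := by
    rw [show ((-1 : ℤ), (0 : ℤ)) = -(1, 0) by simp, map_neg, neg_sq]
  have hneg2 : c (0, -1) ^ 2 = c (0, 1) ^ 2 := by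
    rw [show ((0 : ℤ), (-1 : ℤ)) = -(0, 1) by simp, map_neg, neg_sq]
  obtain ⟨r1, hr1, h1⟩ := exists_step_mgf_le hp hc (d := (1, 0)) (by decide) hvh
  obtain ⟨r2, hr2, h2⟩ := exists_step_mgf_le hp hc (d := (-1, 0)) (by decide)
    (by rw [hneg1]; exact hvh)
  obtain ⟨r3, hr3, h3⟩ := exists_step_mgf_le hp hc (d := (0, 1)) (by decide) hvv
  obtain ⟨r4, hr4, h4⟩ := exists_step_mgf_le hp hc (d := (0, -1)) (by decide)
    (by rw [hneg2]; exact hvv)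
  refine ⟨min (min r1 r2) (min r3 r4), by positivity, ?_⟩
  filter_upwards [hs, eventually_ge_atTop 2] with t hs ht r hr x
  simp only [le_min_iff] at hr
  refine phaseOp_le_of_forall (by omega) fun z hz => ?_
  have hzM := (Finset.mem_Icc.1 hz).2
  set v : ℤ × ℤ → ℝ := fun d => if d.2 = 0 then vh else vv with hv
  refine (survOp_exp_le hp (v := v) (fun d hd => ?_)
    (sum_phase (G_pos hP ht) (H_pos hP hB ht) hzM) x).trans ?_
  · have hd := P.mem_unitSteps_of_mem_phase hd
    simp only [unitSteps, Finset.mem_insert, Finset.mem_singleton] at hd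
    rcases hd with rfl | rfl | rfl | rfl
    · exact h1 r hr.1.1
    · exact h2 r hr.1.2
    · exact h3 r hr.2.1
    · exact h4 r hr.2.2
  · rw [sum_map_phase (v := v) (vh := vh) (vv := vv) rfl rfl rfl rfl (G_pos hP ht)
      (H_pos hP hB ht) hzM]
    gcongr

/-! ### All phases -/

/-- The expectation of a function of the position at the start of the `i`-th phase, on the event
that the home has not been visited. -/
noncomputable def survFunctional (P : SweepParams) (p : ℝ) (home : ℤ × ℤ) :
    ℕ → (ℤ × ℤ → ℝ) →ₗ[ℝ] ℝ
  | 0 => LinearMap.proj 0 ∘ₗ survOp p home [(1, 0), (-1, 0)]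
  | i + 1 => survFunctional P p home i ∘ₗ P.phaseOp p home (P.startTime i)

theorem survFunctional_succ (i : ℕ) (f : ℤ × ℤ → ℝ) : P.survFunctional p home (i + 1) f =
    P.survFunctional p home i (P.phaseOp p home (P.startTime i) f) := rfl

theorem survFunctional_mono (hp : p ∈ Set.Icc (0 : ℝ) 1) (i : ℕ) (f g : ℤ × ℤ → ℝ) (h : f ≤ g) :
    P.survFunctional p home i f ≤ P.survFunctional p home i g := by
  induction i generalizing f g with
  | zero => exact survOp_mono (home := home) hp [(1, 0), (-1, 0)] h 0
  | succ i ih => exact ih _ _ (phaseOp_mono hp _ h)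

theorem startTime_succ (i : ℕ) :
    P.startTime (i + 1) = P.startTime i + P.duration (P.startTime i) := rfl

theorem one_le_duration {t : ℕ} (ht : 1 ≤ t) : 1 ≤ P.duration t := by
  have := P.one_le_M ht
  simp only [duration, phase, List.length_append, List.length_replicate]
  omega

theorem strictMono_startTime (P : SweepParams) : StrictMono P.startTime :=
  strictMono_nat_of_lt_succ fun i => by
    have h1 := P.two_le_startTime i
    have := one_le_duration (P := P) (by omega : 1 ≤ P.startTime i)
    rw [startTime_succ]
    omega

/-- The four directions: the two coordinates and their negatives. -/
def dirCoord (k : Bool × Bool) : ℤ × ℤ →+ ℝ :=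
  if k.1 then (if k.2 then fstCoord else -fstCoord) else (if k.2 then sndCoord else -sndCoord)

/-- A scale that depends only on the coordinate. -/
def dirScale (σx σy : ℝ) (k : Bool × Bool) : ℝ := if k.1 then σx else σy

theorem isCoordinate_dirCoord (k : Bool × Bool) : IsCoordinate (dirCoord k) := by
  obtain ⟨b1, b2⟩ := k
  cases b1 <;> cases b2
  exacts [isCoordinate_snd.neg, isCoordinate_snd, isCoordinate_fst.neg, isCoordinate_fst]

theorem dirScale_pos {σx σy : ℝ} (hx : 0 < σx) (hy : 0 < σy) (k : Bool × Bool) :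
    0 < dirScale σx σy k := by
  unfold dirScale
  split_ifs <;> assumption

theorem exists_dirCoord_ge {σx σy b T : ℝ} (hx : 0 < σx) (hy : 0 < σy) {x : ℤ × ℤ}
    (h : ¬ (|(x.1 : ℝ)| ≤ b * σx * T ∧ |(x.2 : ℝ)| ≤ b * σy * T)) :
    ∃ k, b * T ≤ dirCoord k x / dirScale σx σy k := by
  have haux : ∀ k, b * dirScale σx σy k * T ≤ dirCoord k x →
      b * T ≤ dirCoord k x / dirScale σx σy k := by
    intro k hk
    rw [le_div_iff₀ (dirScale_pos hx hy k)]
    linarith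
  rw [not_and_or, not_le, not_le, lt_abs, lt_abs] at h
  rcases h with (h | h) | (h | h)
  · exact ⟨(true, true), haux _ (by simpa [dirCoord, dirScale] using h.le)⟩
  · exact ⟨(true, false), haux _ (by simpa [dirCoord, dirScale] using h.le)⟩
  · exact ⟨(false, true), haux _ (by simpa [dirCoord, dirScale] using h.le)⟩
  · exact ⟨(false, false), haux _ (by simpa [dirCoord, dirScale] using h.le)⟩

/-- Horizontally, σx² bounds the variance of every step. Vertically, horizontal instructions produce
only p/2, and the rare vertical ones can afford the crude bound 2. -/
theorem exists_eventually_phaseOp_exp_dirCoord_le (hp : p ∈ Set.Icc (0 : ℝ) 1) (hP : P.p₀ < 1)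
    (hA : 0 < P.A) (hB : 0 < P.B) {σx σy : ℝ} (hx : p / 2 + p * (1 - p) < σx ^ 2)
    (hy : p / 2 < σy ^ 2) (home : ℤ × ℤ) (k : Bool × Bool) :
    ∃ r₀ > 0, ∀ᶠ t : ℕ in atTop, ∀ r : ℝ, |r| ≤ r₀ → ∀ x,
      P.phaseOp p home t (fun y => Real.exp (r * dirCoord k y)) x ≤
        Real.exp (r ^ 2 / 2 * (dirScale σx σy k ^ 2 * P.duration t)) *
          Real.exp (r * dirCoord k x) := by
  obtain ⟨hp0, hp1⟩ := hp
  have hfst : ∀ᶠ t : ℕ in atTop, (2 * P.W t * (P.N t + 1)) * σx ^ 2 +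
      (2 * ((P.N t - 1) * P.G t) + 2 * P.M t) * σx ^ 2 ≤ σx ^ 2 * P.duration t := by
    filter_upwards [eventually_ge_atTop 2] with t ht
    rw [duration_eq hP hB ht]
    linarith
  have hsnd : ∀ᶠ t : ℕ in atTop, (2 * P.W t * (P.N t + 1)) * ((p / 2 + σy ^ 2) / 2) +
      (2 * ((P.N t - 1) * P.G t) + 2 * P.M t) * 2 ≤ σy ^ 2 * P.duration t := by
    -- With variance bound 2 for vertical steps, 2ε is exactly the gap between (p/2 + σy²)/2 and
    -- σy².
    filter_upwards [eventually_vertical_le hP hA hB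
      (ε := (σy ^ 2 - p / 2) / 4) (by linarith), eventually_ge_atTop 2] with t hv ht
    have hN : (1 : ℝ) ≤ P.N t := by exact_mod_cast N_pos (G_pos hP ht) (H_pos hP hB ht)
    have hG : (0 : ℝ) ≤ P.G t := Nat.cast_nonneg _
    have hM : (0 : ℝ) ≤ P.M t := Nat.cast_nonneg _
    have hnn := mul_nonneg (sub_nonneg.2 hN) hG
    have hD := duration_eq hP hB ht
    have h1 : (2 * P.W t * (P.N t + 1) : ℝ) ≤ P.duration t := by linarith
    have h2 := mul_le_mul_of_nonneg_right h1 (show 0 ≤ (p / 2 + σy ^ 2) / 2 by linarith)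
    linarith
  have hpp : p * (1 - p) ≤ 1 := by nlinarith
  have hpp0 : 0 ≤ p * (1 - p) := mul_nonneg hp0 (by linarith)
  have hc := isCoordinate_dirCoord k
  obtain ⟨b1, b2⟩ := k
  cases b1
  · refine exists_eventually_phaseOp_exp_le ⟨hp0, hp1⟩ hP hB hc (vv := 2) ?_ ?_ hsnd home
    · cases b2 <;> simp [dirCoord] <;> linarith
    · cases b2 <;> simp [dirCoord] <;> linarith
  · refine exists_eventually_phaseOp_exp_le ⟨hp0, hp1⟩ hP hB hc ?_ ?_ hfst home
    · cases b2 <;> simp [dirCoord] <;> linarith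
    · cases b2 <;> simp [dirCoord] <;> linarith

/-- Outside the box some normalized direction is at least b√t, so its exponential is at least
exp(b²/2) and the factor after ρ is at least 1. The rate α = b/2 minimizes α² - αb, the part of the
error exponent that depends on α. -/
theorem phaseOp_one_le_exp (hp : p ∈ Set.Icc (0 : ℝ) 1) {t : ℕ} (ht : 1 ≤ t) {σx σy b ρ : ℝ}
    (hx : 0 < σx) (hy : 0 < σy) (hb : 0 < b) (hρ : 0 ≤ ρ)
    (hbox : ∀ x : ℤ × ℤ, |(x.1 : ℝ)| ≤ b * σx * √(t : ℝ) → |(x.2 : ℝ)| ≤ b * σy * √(t : ℝ) →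
      P.phaseOp p home t (fun _ => 1) x ≤ 1 - ρ) :
    P.phaseOp p home t (fun _ => 1) ≤ (1 - ρ) • (fun _ => (1 : ℝ)) +
      ρ • (Real.exp (-(b ^ 2 / 2)) • ∑ k, fun x =>
        Real.exp (b / 2 / √(t : ℝ) * (dirCoord k x / dirScale σx σy k))) := by
  intro x
  simp only [Pi.add_apply, Pi.smul_apply, Finset.sum_apply, smul_eq_mul, mul_one]
  set S := ∑ k, Real.exp (b / 2 / √(t : ℝ) * (dirCoord k x / dirScale σx σy k)) with hS
  have hS0 : 0 ≤ S := Finset.sum_nonneg fun k _ => (Real.exp_pos _).le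
  by_cases hin : |(x.1 : ℝ)| ≤ b * σx * √(t : ℝ) ∧ |(x.2 : ℝ)| ≤ b * σy * √(t : ℝ)
  · have h1 := hbox x hin.1 hin.2
    have h2 : 0 ≤ ρ * (Real.exp (-(b ^ 2 / 2)) * S) := by positivity
    linarith
  · obtain ⟨k, hk⟩ := exists_dirCoord_ge hx hy hin
    have htpos : (0 : ℝ) < t := by exact_mod_cast ht
    have hsq : 0 < √(t : ℝ) := Real.sqrt_pos.2 htpos
    have h1 : Real.exp (b ^ 2 / 2) ≤ S := by
      refine le_trans (Real.exp_le_exp.2 ?_) (Finset.single_le_sum (f := fun k =>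
        Real.exp (b / 2 / √(t : ℝ) * (dirCoord k x / dirScale σx σy k)))
        (fun k _ => (Real.exp_pos _).le) (Finset.mem_univ k))
      calc b ^ 2 / 2 = b / 2 / √(t : ℝ) * (b * √(t : ℝ)) := by field_simp
        _ ≤ _ := by gcongr
    have h2 : 1 ≤ Real.exp (-(b ^ 2 / 2)) * S := by
      calc (1 : ℝ) = Real.exp (-(b ^ 2 / 2)) * Real.exp (b ^ 2 / 2) := by
            rw [← Real.exp_add, neg_add_cancel, Real.exp_zero]
        _ ≤ _ := by gcongr
    have h3 := phaseOp_one_le_one (P := P) (home := home) hp ht x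
    have h4 := mul_le_mul_of_nonneg_left h2 hρ
    linarith

/-- The rates α/√T tend to 0, so the small-parameter bounds apply eventually; dividing by `dirScale`
normalizes the variance to one per time step. -/
theorem eventually_survFunctional_exp_le (hp : p ∈ Set.Icc (0 : ℝ) 1) (hP : P.p₀ < 1)
    (hA : 0 < P.A) (hB : 0 < P.B) {σx σy : ℝ} (hx0 : 0 < σx) (hy0 : 0 < σy)
    (hx : p / 2 + p * (1 - p) < σx ^ 2) (hy : p / 2 < σy ^ 2) (home : ℤ × ℤ) (α : ℝ) :
    ∀ᶠ i in atTop, ∀ k, P.survFunctional p home (i + 1) (fun x =>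
        Real.exp (α / √(P.startTime (i + 1) : ℝ) * (dirCoord k x / dirScale σx σy k))) ≤
      Real.exp (α ^ 2 / (2 * (P.startTime (i + 1) : ℝ)) * P.duration (P.startTime i)) *
        P.survFunctional p home i (fun x =>
          Real.exp (α / √(P.startTime (i + 1) : ℝ) * (dirCoord k x / dirScale σx σy k))) := by
  choose r₀ hr₀ hmom using
    exists_eventually_phaseOp_exp_dirCoord_le hp hP hA hB hx hy home
  have hT := P.strictMono_startTime.tendsto_atTop
  have hr : ∀ᶠ i in atTop, ∀ k,
      |α / √(P.startTime (i + 1) : ℝ) / dirScale σx σy k| ≤ r₀ k := by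
    refine eventually_all.2 fun k => ?_
    have h1 : Tendsto (fun i => α / √(P.startTime (i + 1) : ℝ) / dirScale σx σy k) atTop
        (𝓝 (0 / dirScale σx σy k)) :=
      (((tendsto_sqrt_natCast.comp hT).comp (tendsto_add_atTop_nat 1)).const_div_atTop
        α).div_const _
    rw [zero_div] at h1
    have h2 := h1.abs
    rw [abs_zero] at h2
    exact (h2.eventually (gt_mem_nhds (hr₀ k))).mono fun i hi => hi.le
  filter_upwards [hr, hT.eventually (eventually_all.2 hmom)] with i hr hm k
  have h3 := hm k _ (hr k)
  have hσ := dirScale_pos hx0 hy0 k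
  have e1 : ∀ x, α / √(P.startTime (i + 1) : ℝ) / dirScale σx σy k * dirCoord k x
      = α / √(P.startTime (i + 1) : ℝ) * (dirCoord k x / dirScale σx σy k) := fun x => by ring
  simp only [e1] at h3
  have e2 : (α / √(P.startTime (i + 1) : ℝ) / dirScale σx σy k) ^ 2 / 2 *
      (dirScale σx σy k ^ 2 * P.duration (P.startTime i))
      = α ^ 2 / (2 * P.startTime (i + 1)) * P.duration (P.startTime i) := by
    rw [div_pow, div_pow, Real.sq_sqrt (Nat.cast_nonneg _)]
    field_simp
  rw [e2] at h3
  rw [survFunctional_succ]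
  refine (survFunctional_mono hp i _ _ h3).trans_eq ?_
  exact (P.survFunctional p home i).map_smul _ _

/-- Polynomial decay of the survival probability, in terms of constants with some room. -/
theorem exists_survFunctional_le_of_lt (hp0 : 0 ≤ p) (hp : p < P.p₀) (hP : P.p₀ < 1)
    {σx σy b h h' q ε : ℝ} (hx0 : 0 < σx) (hy0 : 0 < σy) (hb : 0 < b)
    (hA : P.A = b * σx) (hB : P.B = b * σy)
    (hx : p / 2 + p * (1 - p) < σx ^ 2) (hy : p / 2 < σy ^ 2) (hh : 0 < h) (hhh' : h < h')
    (hε : 0 < ε) (hε1 : ε < 1) (hq : 4 * (P.A / (1 - P.p₀)) * (P.B / (1 - P.p₀)) < q)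
    (hhq : h * q ≤ (1 - ε) * (1 - 4 * Real.exp (2 * h' - b ^ 2 / 4))) (home : ℤ × ℤ) :
    ∃ C : ℝ, ∀ᶠ i in atTop,
      P.survFunctional p home i (fun _ => 1) ≤ C * (P.startTime i : ℝ) ^ (-h) := by
  have hpI : p ∈ Set.Icc (0 : ℝ) 1 := ⟨hp0, by linarith⟩
  have hA0 : 0 < P.A := by rw [hA]; positivity
  have hB0 : 0 < P.B := by rw [hB]; positivity
  have hT := P.strictMono_startTime.tendsto_atTop
  refine exists_mass_le_rpow (Λ := P.survFunctional p home) (survFunctional_mono hpI)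
    (T := fun i => P.startTime i) (L := fun i => P.duration (P.startTime i))
    (φ := fun k x => dirCoord k x / dirScale σx σy k) (α := b / 2) (b := b ^ 2 / 2)
    (h := h) (h' := h')
    (fun i => ?_) (fun i => Nat.cast_nonneg _) (fun i => ?_) hh hhh' ?_
    (eventually_survFunctional_exp_le hpI hP hA0 hB0 hx0 hy0 hx hy home _) ?_
  · have := P.two_le_startTime i
    exact_mod_cast (by omega : 1 ≤ P.startTime i)
  · exact_mod_cast startTime_succ i
  · refine hT.eventually (eventually_duration_le hP hA0 hB0 ?_)
    rw [sub_pos, one_lt_div hh]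
    exact hhh'
  · filter_upwards [hT.eventually (eventually_phaseOp_one_le hp0 hp hP hA0 hB0 home hε),
      hT.eventually (eventually_duration_mul_M_le hP hA0 hB0 hq)] with i hbox hDM
    have ht2 := P.two_le_startTime i
    set t := P.startTime i with ht
    have hM1 : (1 : ℝ) ≤ P.M t := by exact_mod_cast P.one_le_M (by omega : 1 ≤ t)
    have hMpos : (0 : ℝ) < P.M t := by linarith
    have hρ0 : 0 ≤ (1 - ε) / P.M t := div_nonneg (by linarith) hMpos.le
    refine ⟨(1 - ε) / P.M t, hρ0, ?_, ?_, ?_⟩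
    · rw [div_le_one hMpos]
      linarith
    · have e : (Fintype.card (Bool × Bool) : ℝ) = 4 := by simp
      have e2 : 2 * h' + (b / 2) ^ 2 - b ^ 2 / 2 = 2 * h' - b ^ 2 / 4 := by ring
      rw [e, e2, div_mul_eq_mul_div, div_mul_eq_mul_div, le_div_iff₀ hMpos]
      calc h * (P.duration t : ℝ) * P.M t = h * (P.duration t * P.M t) := by ring
        _ ≤ h * (q * t) := by gcongr
        _ = h * q * t := by ring
        _ ≤ _ := by gcongr
    · rw [survFunctional_succ]
      rw [hA, hB] at hbox
      refine (survFunctional_mono hpI i _ _ (phaseOp_one_le_exp hpI (by omega : 1 ≤ t) hx0 hy0 hb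
        hρ0 hbox)).trans_eq ?_
      rw [map_add, map_smul, map_smul, map_smul, map_sum]
      simp only [smul_eq_mul]

/-- The probability that the home has not been visited before the `i`-th phase decays faster than
the reciprocal of its starting time. -/
theorem exists_survFunctional_le {a : ℝ} (ha : 0 < a) (hp0 : 0 ≤ p) (hp : p < P.p₀)
    (hP : P.p₀ < 1 / 2) (hA : P.A = a * √(P.p₀ / 2 * (3 - 2 * P.p₀))) (hB : P.B = a * √(P.p₀ / 2))
    (heq : 4 * (P.A / (1 - P.p₀)) * (P.B / (1 - P.p₀)) = 1 - 4 * Real.exp (-a ^ 2 / 4 + 2))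
    (home : ℤ × ℤ) :
    ∃ h : ℝ, 1 < h ∧ ∃ C : ℝ, ∀ᶠ i in atTop,
      P.survFunctional p home i (fun _ => 1) ≤ C * (P.startTime i : ℝ) ^ (-h) := by
  have hP0 : 0 < P.p₀ := lt_of_le_of_lt hp0 hp
  have hP1 : P.p₀ < 1 := by linarith
  have h1p : 0 < 1 - P.p₀ := by linarith
  set cx := P.p₀ / 2 * (3 - 2 * P.p₀) with hcx
  set cy := P.p₀ / 2 with hcy
  have hcx0 : 0 < cx := mul_pos (by positivity) (by linarith)
  have hcy0 : 0 < cy := by positivity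
  have hA0 : 0 < P.A := by rw [hA]; positivity
  have hB0 : 0 < P.B := by rw [hB]; positivity
  have hcx' : p / 2 + p * (1 - p) < cx := by rw [hcx]; nlinarith
  have hcy' : p / 2 < cy := by rw [hcy]; linarith
  -- As p < p₀, both variances are strictly below those at p₀, so the scales can be shrunk by τ < 1.
  -- In the new units the same box has half-width b = a/τ > a.
  obtain ⟨τ, hτ0, hτ1, hτx, hτy⟩ : ∃ τ : ℝ, 0 < τ ∧ τ < 1 ∧ p / 2 + p * (1 - p) < τ ^ 2 * cx ∧
      p / 2 < τ ^ 2 * cy := by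
    have hx : Tendsto (fun τ : ℝ => τ ^ 2 * cx) (𝓝[<] 1) (𝓝 (1 ^ 2 * cx)) :=
      ((by fun_prop : Continuous fun τ : ℝ => τ ^ 2 * cx).tendsto 1).mono_left nhdsWithin_le_nhds
    have hy : Tendsto (fun τ : ℝ => τ ^ 2 * cy) (𝓝[<] 1) (𝓝 (1 ^ 2 * cy)) :=
      ((by fun_prop : Continuous fun τ : ℝ => τ ^ 2 * cy).tendsto 1).mono_left nhdsWithin_le_nhds
    have h0 : ∀ᶠ τ : ℝ in 𝓝[<] 1, 0 < τ := nhdsWithin_le_nhds (lt_mem_nhds one_pos)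
    have h1 : ∀ᶠ τ : ℝ in 𝓝[<] 1, τ < 1 := eventually_mem_nhdsWithin
    obtain ⟨τ, h⟩ := (h0.and (h1.and ((hx.eventually (lt_mem_nhds (by simpa using hcx'))).and
      (hy.eventually (lt_mem_nhds (by simpa using hcy')))))).exists
    exact ⟨τ, h.1, h.2.1, h.2.2.1, h.2.2.2⟩
  set b := a / τ with hb
  have hab : a < b := by rw [hb, lt_div_iff₀ hτ0]; nlinarith
  have hb0 : 0 < b := ha.trans hab
  -- Then 2h' - b²/4 = 2 - a²/4 - (b² - a²)/8: half of the gain from b > a pays for h' > 1.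
  set h' := 1 + (b ^ 2 - a ^ 2) / 16 with hh'
  have hsq : a ^ 2 < b ^ 2 := by gcongr
  have hh'1 : 1 < h' := by rw [hh']; linarith
  set q := 1 - 4 * Real.exp (2 * h' - b ^ 2 / 4) with hq
  set q0 := 1 - 4 * Real.exp (-a ^ 2 / 4 + 2) with hq0
  have hq0pos : 0 < q0 := by rw [← heq]; positivity
  have hqq : q0 < q := by
    have : Real.exp (2 * h' - b ^ 2 / 4) < Real.exp (-a ^ 2 / 4 + 2) := by
      apply Real.exp_lt_exp.2
      rw [hh']
      linarith
    linarith
  set q1 := (q0 + q) / 2 with hq1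
  have hq1pos : 0 < q1 := by rw [hq1]; linarith
  -- The room q/q1 = s² is split evenly: one factor s lets h exceed 1, the other pays for 1 - ε =
  -- 1/s.
  set s := √(q / q1) with hs
  have hs1 : 1 < s := by
    rw [hs, Real.lt_sqrt (by norm_num), one_pow, one_lt_div hq1pos]
    linarith
  have hs0 : 0 < s := by linarith
  have hss : s * s * q1 = q := by
    rw [hs, Real.mul_self_sqrt (div_nonneg (by linarith) hq1pos.le)]
    field_simp
  refine ⟨min ((1 + h') / 2) s, lt_min (by linarith) hs1, ?_⟩
  refine exists_survFunctional_le_of_lt (σx := τ * √cx) (σy := τ * √cy) (b := b) (h' := h')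
    (q := q1) (ε := 1 - 1 / s) hp0 hp hP1 (by positivity) (by positivity) hb0 ?_ ?_ ?_ ?_ ?_ ?_ ?_
    ?_ ?_ ?_ home
  · rw [hA, hb]; field_simp
  · rw [hB, hb]; field_simp
  · rw [mul_pow, Real.sq_sqrt hcx0.le]; exact hτx
  · rw [mul_pow, Real.sq_sqrt hcy0.le]; exact hτy
  · exact lt_min (by linarith) hs0
  · exact lt_of_le_of_lt (min_le_left _ _) (by linarith)
  · rw [sub_pos, div_lt_one hs0]; exact hs1
  · have : 0 < 1 / s := by positivity
    linarith
  · rw [heq, hq1]; linarith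
  · calc min ((1 + h') / 2) s * q1 ≤ s * q1 := by gcongr; exact min_le_right _ _
      _ = 1 / s * (s * s * q1) := by field_simp
      _ = (1 - (1 - 1 / s)) * q := by rw [hss, sub_sub_cancel]

end SweepParams

/-! ### Integrals over infinite product spaces -/

open Classical in
/-- Extend a finite sequence by a constant. -/
noncomputable def extendRange {E : Type*} [Nonempty E] (n : ℕ) (y : Finset.range n → E) (i : ℕ) :
    E :=
  if h : i ∈ Finset.range n then y ⟨i, h⟩ else Classical.arbitrary E

theorem extendRange_restrict {E : Type*} [Nonempty E] {n i : ℕ} (ω : ℕ → E) (hi : i < n) :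
    extendRange n ((Finset.range n).restrict ω) i = ω i := by
  simp [extendRange, hi]

theorem lintegral_uniformOn_finset {E : Type*} [MeasurableSpace E] [MeasurableSingletonClass E]
    (s : Finset E) (f : E → ℝ≥0∞) :
    ∫⁻ x, f x ∂(uniformOn (s : Set E)) = (s.card : ℝ≥0∞)⁻¹ * ∑ x ∈ s, f x := by
  rw [uniformOn, ProbabilityTheory.cond, lintegral_smul_measure, lintegral_finset]
  simp

section product

variable {E E' : Type*} [MeasurableSpace E] [Countable E] [MeasurableSingletonClass E]
  [MeasurableSpace E'] [Countable E'] [MeasurableSingletonClass E']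

/-- The last coordinate may be integrated out first. -/
theorem lintegral_infinitePi_eval (μ : ℕ → Measure E) [∀ i, IsProbabilityMeasure (μ i)] (n : ℕ)
    (F : (ℕ → E) → E → ℝ≥0∞) (hF : ∀ ω ω' e, (∀ i < n, ω i = ω' i) → F ω e = F ω' e) :
    ∫⁻ ω, F ω (ω n) ∂(Measure.infinitePi μ) =
      ∫⁻ ω, ∫⁻ e, F ω e ∂(μ n) ∂(Measure.infinitePi μ) := by
  have : Nonempty E := (μ 0).nonempty_of_neZero
  -- F factors through n coordinates in a countable discrete space, so no measurability of F need be
  -- assumed.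
  set R : (ℕ → E) → (Finset.range n → E) := (Finset.range n).restrict with hR
  have hRm : Measurable R := Finset.measurable_restrict _
  have hFR : ∀ ω e, F ω e = F (extendRange n (R ω)) e := fun ω e =>
    hF _ _ _ fun i hi => (extendRange_restrict ω hi).symm
  have hind : IndepFun R (fun ω : ℕ → E => ω n) (Measure.infinitePi μ) := by
    have h1 : iIndepFun (fun i (ω : ℕ → E) => ω i) (Measure.infinitePi μ) :=
      iIndepFun_infinitePi (X := fun _ x => x) fun _ => measurable_id
    have h2 := h1.indepFun_finset (Finset.range n) {n} (by simp) fun i => measurable_pi_apply i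
    exact h2.comp (φ := id) (ψ := fun y : ({n} : Finset ℕ) → E => y ⟨n, by simp⟩)
      measurable_id (measurable_pi_apply _)
  have hprod := hind.map_prod_eq_prod_map_map hRm.aemeasurable
    (measurable_pi_apply n).aemeasurable
  rw [Measure.infinitePi_map_eval] at hprod
  have hm : Measurable fun q : (Finset.range n → E) × E => F (extendRange n q.1) q.2 :=
    Measurable.of_discrete
  calc ∫⁻ ω, F ω (ω n) ∂(Measure.infinitePi μ)
      = ∫⁻ ω, (fun q : (Finset.range n → E) × E => F (extendRange n q.1) q.2) (R ω, ω n)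
          ∂(Measure.infinitePi μ) := lintegral_congr fun ω => hFR ω _
    _ = ∫⁻ q, F (extendRange n q.1) q.2
          ∂((Measure.infinitePi μ).map fun ω => (R ω, ω n)) :=
        (lintegral_map hm (hRm.prodMk (measurable_pi_apply n))).symm
    _ = ∫⁻ y, ∫⁻ e, F (extendRange n y) e ∂(μ n) ∂((Measure.infinitePi μ).map R) := by
        rw [hprod, lintegral_prod _ hm.aemeasurable]
    _ = ∫⁻ ω, ∫⁻ e, F (extendRange n (R ω)) e ∂(μ n) ∂(Measure.infinitePi μ) :=
        lintegral_map Measurable.of_discrete hRm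
    _ = _ := lintegral_congr fun ω => lintegral_congr fun e => (hFR ω e).symm

/-- A function of finitely many discrete coordinates is measurable. -/
theorem measurable_of_forall_lt [Nonempty E] [Nonempty E'] {β : Type*} [MeasurableSpace β] (n : ℕ)
    (F : (ℕ → E) × (ℕ → E') → β) (hF : ∀ q q' : (ℕ → E) × (ℕ → E'),
      (∀ i < n, q.1 i = q'.1 i) → (∀ i < n, q.2 i = q'.2 i) → F q = F q') : Measurable F := by
  have hm : Measurable fun q : (Finset.range n → E) × (Finset.range n → E') =>
      F (extendRange n q.1, extendRange n q.2) := Measurable.of_discrete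
  have hr : Measurable fun q : (ℕ → E) × (ℕ → E') =>
      ((Finset.range n).restrict q.1, (Finset.range n).restrict q.2) :=
    ((Finset.measurable_restrict _).comp measurable_fst).prodMk
      ((Finset.measurable_restrict _).comp measurable_snd)
  convert hm.comp hr using 1
  ext q
  exact hF _ _ (fun i hi => (extendRange_restrict q.1 hi).symm)
    (fun i hi => (extendRange_restrict q.2 hi).symm)

end product

/-! ### The guided walk as a killed Markov chain -/

theorem lintegral_stepNoiseLaw (p : unitInterval) (f : Bool × (ℤ × ℤ) → ℝ≥0∞) :
    ∫⁻ e, f e ∂(stepNoiseLaw p) = ENNReal.ofReal p * (4⁻¹ * ∑ s ∈ unitSteps, f (true, s)) +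
      ENNReal.ofReal (1 - p) * (4⁻¹ * ∑ s ∈ unitSteps, f (false, s)) := by
  have : IsProbabilityMeasure (uniformOn (unitSteps : Set (ℤ × ℤ))) :=
    isProbabilityMeasure_uniformOn unitSteps.finite_toSet ⟨(1, 0), by simp [unitSteps]⟩
  rw [stepNoiseLaw, lintegral_prod _ Measurable.of_discrete.aemeasurable]
  simp only [lintegral_uniformOn_finset, card_unitSteps, bernoulliMeasure_def]
  rw [lintegral_add_measure, lintegral_smul_measure, lintegral_smul_measure, lintegral_dirac,
    lintegral_dirac, ENNReal.smul_def, ENNReal.smul_def, smul_eq_mul, smul_eq_mul,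
    ENNReal.ofReal_eq_coe_nnreal p.2.1,
    ENNReal.ofReal_eq_coe_nnreal (sub_nonneg.2 p.2.2)]
  rfl

theorem lintegral_stepNoiseLaw_step (p : unitInterval) {k : ℤ × ℤ → ℝ} (hk : ∀ y, 0 ≤ k y)
    (x d : ℤ × ℤ) :
    ∫⁻ e, ENNReal.ofReal (k (x + if e.1 then e.2 else d)) ∂(stepNoiseLaw p) =
      ENNReal.ofReal ((1 - p) * k (x + d) + p / 4 * ∑ s ∈ unitSteps, k (x + s)) := by
  have hp0 : (0 : ℝ) ≤ p := p.2.1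
  have hp1 : (0 : ℝ) ≤ 1 - p := by linarith [p.2.2]
  have h4 : (4 : ℝ≥0∞)⁻¹ = ENNReal.ofReal (4⁻¹) := by
    rw [ENNReal.ofReal_inv_of_pos (by norm_num)]; norm_num
  have hs : 0 ≤ ∑ s ∈ unitSteps, k (x + s) := Finset.sum_nonneg fun s _ => hk _
  rw [lintegral_stepNoiseLaw]
  simp only [if_true, Bool.false_eq_true, if_false, Finset.sum_const, card_unitSteps]
  rw [← ENNReal.ofReal_sum_of_nonneg fun s _ => hk _, h4, ← ENNReal.ofReal_mul (by norm_num),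
    ← ENNReal.ofReal_mul hp0, nsmul_eq_mul, ← ENNReal.ofReal_natCast,
    ← ENNReal.ofReal_mul (by norm_num), ← ENNReal.ofReal_mul (by norm_num),
    ← ENNReal.ofReal_mul hp1, ← ENNReal.ofReal_add]
  · congr 1
    push_cast
    ring
  · positivity
  · have := hk (x + d)
    positivity

theorem guidedWalk_congr {x x' : ℕ → ℤ × ℤ} {ω ω' : ℕ → Bool × (ℤ × ℤ)} {n : ℕ}
    (hx : ∀ i ≤ n, x i = x' i) (hω : ∀ i < n, ω i = ω' i) :
    guidedWalk x ω n = guidedWalk x' ω' n := by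
  induction n with
  | zero => rfl
  | succ n ih =>
    rw [guidedWalk, guidedWalk, ih (fun i hi => hx i (by omega)) (fun i hi => hω i (by omega)),
      hω n (by omega), hx n (by omega), hx (n + 1) le_rfl]

open Classical in
/-- The indicator of the event that `home` is not visited at the times `1, …, n`. -/
noncomputable def notHit (home : ℤ × ℤ) (X : ℕ → ℤ × ℤ) (n : ℕ) : ℝ :=
  if ∀ s, 1 ≤ s → s ≤ n → X s ≠ home then 1 else 0

theorem notHit_congr {home : ℤ × ℤ} {X X' : ℕ → ℤ × ℤ} {n : ℕ} (h : ∀ s ≤ n, X s = X' s) :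
    notHit home X n = notHit home X' n := by
  unfold notHit
  congr 1
  exact propext (forall_congr' fun s => forall_congr' fun _ => forall_congr' fun hs => by
    rw [h s hs])

theorem notHit_nonneg (home : ℤ × ℤ) (X : ℕ → ℤ × ℤ) (n : ℕ) : 0 ≤ notHit home X n := by
  unfold notHit; split_ifs <;> norm_num

theorem notHit_le_one (home : ℤ × ℤ) (X : ℕ → ℤ × ℤ) (n : ℕ) : notHit home X n ≤ 1 := by
  unfold notHit; split_ifs <;> norm_num

theorem notHit_succ (home : ℤ × ℤ) (X : ℕ → ℤ × ℤ) (n : ℕ) :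
    notHit home X (n + 1) = notHit home X n * if X (n + 1) = home then 0 else 1 := by
  unfold notHit
  by_cases h : X (n + 1) = home
  · rw [if_pos h, mul_zero, if_neg]
    exact fun h' => h' (n + 1) (by omega) le_rfl h
  · rw [if_neg h, mul_one]
    congr 1
    refine propext ⟨fun h' s h1 h2 => h' s h1 (by omega), fun h' s h1 h2 => ?_⟩
    rcases Nat.lt_or_ge n s with h3 | h3
    · obtain rfl : s = n + 1 := by omega
      exact h
    · exact h' s h1 h3

theorem notHit_antitone (home : ℤ × ℤ) (X : ℕ → ℤ × ℤ) : Antitone (notHit home X) :=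
  antitone_nat_of_succ_le fun n => by
    rw [notHit_succ]
    refine mul_le_of_le_one_right (notHit_nonneg _ _ _) ?_
    split_ifs <;> norm_num

theorem survOp_nonneg {p : ℝ} (hp : p ∈ Set.Icc (0 : ℝ) 1) (home : ℤ × ℤ) (l : List (ℤ × ℤ))
    {f : ℤ × ℤ → ℝ} (hf : ∀ y, 0 ≤ f y) (x : ℤ × ℤ) : 0 ≤ survOp p home l f x := by
  have h := survOp_mono (home := home) hp l (f := 0) (g := f) hf x
  simpa using h

/-- Induction from the end of the list: the last noise is independent of the past, and integrating
it first applies the one-step operator `survOp p home [d]`. -/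
theorem lintegral_noiseLaw_notHit (p : unitInterval) (home : ℤ × ℤ) (l : List (ℤ × ℤ))
    {x : ℕ → ℤ × ℤ} (hx : ∀ t ≤ l.length, x t = (l.take t).sum) {f : ℤ × ℤ → ℝ}
    (hf : ∀ y, 0 ≤ f y) :
    ∫⁻ ω, ENNReal.ofReal (notHit home (guidedWalk x ω) l.length * f (guidedWalk x ω l.length))
      ∂(noiseLaw p) = ENNReal.ofReal (survOp p home l f 0) := by
  induction l using List.reverseRecOn generalizing f with
  | nil =>
    have h0 : ∀ ω, notHit home (guidedWalk x ω) 0 = 1 := fun ω => if_pos fun s h1 h2 => by omega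
    simp [h0, survOp_nil, guidedWalk]
  | append_singleton l d ih =>
    have hp : (p : ℝ) ∈ Set.Icc (0 : ℝ) 1 := p.2
    have hlen : (l ++ [d]).length = l.length + 1 := by simp
    rw [hlen] at hx ⊢
    have hx' : ∀ t ≤ l.length, x t = (l.take t).sum := fun t ht => by
      rw [hx t (by omega), List.take_append_of_le_length ht]
    have hd : x (l.length + 1) - x l.length = d := by
      rw [hx _ le_rfl, hx' _ le_rfl, ← hlen, List.take_length, List.take_length]
      simp
    have hg : ∀ y, 0 ≤ survOp p home [d] f y := survOp_nonneg hp home [d] hf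
    rw [survOp_append, ← ih hx' hg]
    set k : ℤ × ℤ → ℝ := fun y => if y = home then 0 else f y with hk
    have hk0 : ∀ y, 0 ≤ k y := fun y => by simp only [hk]; split_ifs; exacts [le_rfl, hf y]
    have e : ∀ ω : ℕ → Bool × (ℤ × ℤ),
        notHit home (guidedWalk x ω) (l.length + 1) * f (guidedWalk x ω (l.length + 1))
        = notHit home (guidedWalk x ω) l.length *
          k (guidedWalk x ω l.length + if (ω l.length).1 then (ω l.length).2 else d) := by
      intro ω
      rw [notHit_succ, guidedWalk, hd, mul_assoc]
      simp only [hk]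
      split_ifs <;> simp
    simp only [e]
    rw [noiseLaw, lintegral_infinitePi_eval (fun _ => stepNoiseLaw p) l.length
      (fun ω e => ENNReal.ofReal (notHit home (guidedWalk x ω) l.length *
        k (guidedWalk x ω l.length + if e.1 then e.2 else d)))]
    · refine lintegral_congr fun ω => ?_
      simp only [ENNReal.ofReal_mul (notHit_nonneg _ _ _)]
      rw [lintegral_const_mul _ Measurable.of_discrete, lintegral_stepNoiseLaw_step p hk0,
        survOp_singleton]
    · intro ω ω' e h
      have h1 : ∀ s ≤ l.length, guidedWalk x ω s = guidedWalk x ω' s := fun s hs =>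
        guidedWalk_congr (fun _ _ => rfl) fun i hi => h i (by omega)
      rw [notHit_congr h1, h1 _ le_rfl]

/-! ### The survival functionals as integrals over offsets and noise -/

namespace SweepParams

open Filter Topology

variable {P : SweepParams} {home : ℤ × ℤ}

theorem instructions_congr {z z' : ℕ → ℕ} {i : ℕ} (h : ∀ j < i, z j = z' j) :
    P.instructions z i = P.instructions z' i := by
  induction i with
  | zero => rfl
  | succ i ih =>
    rw [instructions, instructions, ih fun j hj => h j (by omega), h i (by omega)]

/-- Integrating the last offset first turns its phase into the average `phaseOp`, which passes
through the earlier operators by linearity. -/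
theorem lintegral_offsetLaw_survOp (p : unitInterval) (i : ℕ) {f : ℤ × ℤ → ℝ}
    (hf : ∀ y, 0 ≤ f y) :
    ∫⁻ z, ENNReal.ofReal (survOp p home (P.instructions z i) f 0) ∂P.offsetLaw
      = ENNReal.ofReal (P.survFunctional p home i f) := by
  have hp : (p : ℝ) ∈ Set.Icc (0 : ℝ) 1 := p.2
  induction i generalizing f with
  | zero => simp [instructions, survFunctional]
  | succ i ih =>
    set t := P.startTime i with ht
    have hM : 0 < P.M t := P.one_le_M (le_trans (by norm_num) (P.two_le_startTime i))
    have hM' : (0 : ℝ) < P.M t := by exact_mod_cast hM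
    have hnn : ∀ z y, 0 ≤ survOp p home (P.phase t z) f y := fun z => survOp_nonneg hp home _ hf
    have hg : ∀ y, 0 ≤ P.phaseOp p home t f y := fun y => by
      rw [phaseOp_apply]
      exact mul_nonneg (by positivity) (Finset.sum_nonneg fun z _ => hnn z y)
    rw [survFunctional_succ, ← ih hg]
    simp only [instructions, survOp_append]
    rw [offsetLaw, lintegral_infinitePi_eval
      (fun i => uniformOn (Set.Icc 1 (P.M (P.startTime i)))) i
      (fun z e => ENNReal.ofReal (survOp p home (P.instructions z i)
        (survOp p home (P.phase (P.startTime i) e) f) 0))]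
    · refine lintegral_congr fun z => ?_
      rw [← ht, ← Finset.coe_Icc, lintegral_uniformOn_finset,
        ← ENNReal.ofReal_sum_of_nonneg fun e _ => survOp_nonneg hp home _ (hnn e) 0,
        Nat.card_Icc, Nat.add_sub_cancel, ← ENNReal.ofReal_natCast,
        ← ENNReal.ofReal_inv_of_pos hM', ← ENNReal.ofReal_mul (by positivity)]
      congr 1
      rw [phaseOp, LinearMap.smul_apply, map_smul, LinearMap.sum_apply, map_sum]
      simp [Finset.sum_apply]
    · intro z z' e h
      rw [instructions_congr h]

/-- For a larger offset, `M - z` would truncate and the duration of the phase would change with `z`.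
-/
theorem ae_offset_le (P : SweepParams) : ∀ᵐ z ∂P.offsetLaw, ∀ i, z i ≤ P.M (P.startTime i) := by
  refine ae_all_iff.2 fun i => ?_
  have h := measurePreserving_eval_infinitePi
    (fun i => uniformOn (Set.Icc 1 (P.M (P.startTime i)))) i
  refine h.quasiMeasurePreserving.ae (p := fun e => e ≤ P.M (P.startTime i)) ?_
  have : ∀ᵐ e ∂(uniformOn (Set.Icc 1 (P.M (P.startTime i)))), e ∈ Set.Icc 1 (P.M (P.startTime i)) :=
    ae_cond_mem measurableSet_Icc
  exact this.mono fun e he => he.2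

theorem length_instructions (hp : P.p₀ < 1) (hB : 0 < P.B) {z : ℕ → ℕ}
    (hz : ∀ i, z i ≤ P.M (P.startTime i)) (i : ℕ) :
    (P.instructions z i).length = P.startTime i := by
  induction i with
  | zero => rfl
  | succ i ih =>
    rw [instructions, List.length_append, ih, startTime_succ,
      length_phase_eq_duration hp hB (P.two_le_startTime i) (hz i)]

theorem instructions_prefix (z : ℕ → ℕ) {i j : ℕ} (hij : i ≤ j) :
    P.instructions z i <+: P.instructions z j := by
  induction j, hij using Nat.le_induction with
  | base => exact List.prefix_rfl
  | succ j _ ih => exact ih.trans (List.prefix_append _ _)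

/-- Instruction lists extend one another, and t phases contain at least t instructions, so any
sufficiently long list gives the same walk. -/
theorem sweepWalk_eq (hp : P.p₀ < 1) (hB : 0 < P.B) {z : ℕ → ℕ}
    (hz : ∀ i, z i ≤ P.M (P.startTime i)) {i t : ℕ} (ht : t ≤ (P.instructions z i).length) :
    P.sweepWalk z t = ((P.instructions z i).take t).sum := by
  have ht' : t ≤ (P.instructions z t).length := by
    rw [length_instructions hp hB hz]
    exact P.strictMono_startTime.le_apply
  rw [sweepWalk]
  rcases le_total t i with h | h
  · obtain ⟨r, hr⟩ := P.instructions_prefix z h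
    rw [← hr, List.take_append_of_le_length ht']
  · obtain ⟨r, hr⟩ := P.instructions_prefix z h
    rw [← hr, List.take_append_of_le_length ht]

/-- The survival indicator of the guided walk. -/
noncomputable def survInd (P : SweepParams) (home : ℤ × ℤ) (n : ℕ)
    (q : (ℕ → ℕ) × (ℕ → Bool × (ℤ × ℤ))) : ℝ≥0∞ :=
  ENNReal.ofReal (notHit home (guidedWalk (P.sweepWalk q.1) q.2) n)

theorem measurable_survInd (n : ℕ) : Measurable (P.survInd home n) := by
  refine measurable_of_forall_lt n _ fun q q' h1 h2 => ?_
  unfold survInd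
  congr 1
  refine notHit_congr fun s hs => guidedWalk_congr (fun i hi => ?_) fun i hi => h2 i (by omega)
  rw [sweepWalk, sweepWalk, instructions_congr fun j hj => h1 j (by omega)]

theorem lintegral_survInd (hp : P.p₀ < 1) (hB : 0 < P.B) (p : unitInterval) (i : ℕ) :
    ∫⁻ q, P.survInd home (P.startTime i) q ∂(P.law p)
      = ENNReal.ofReal (P.survFunctional p home i (fun _ => 1)) := by
  rw [law, lintegral_prod _ (measurable_survInd _).aemeasurable,
    ← lintegral_offsetLaw_survOp p i fun _ => zero_le_one]
  refine lintegral_congr_ae (P.ae_offset_le.mono fun z hz => ?_)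
  have h := lintegral_noiseLaw_notHit p home (P.instructions z i) (x := P.sweepWalk z)
    (fun t ht => sweepWalk_eq hp hB hz ht) (f := fun _ => 1) fun _ => zero_le_one
  simp only [mul_one] at h
  rw [length_instructions hp hB hz] at h
  exact h

end SweepParams

/-! ### From survival probabilities to the expected hitting time -/

open Classical in
-- The hitting time counts the n with no visit up to time n. Since `notHit` ignores time 0, only an
-- inequality results.
theorem hittingTime_le_tsum (X : ℕ → ℤ × ℤ) (home : ℤ × ℤ) :
    hittingTime X home ≤ ∑' n, ENNReal.ofReal (notHit home X n) := by
  have hone : ∀ n, (∀ s, 1 ≤ s → s ≤ n → X s ≠ home) → ENNReal.ofReal (notHit home X n) = 1 :=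
    fun n h => by rw [notHit, if_pos h, ENNReal.ofReal_one]
  by_cases h : ∃ t, X t = home
  · have hT : hittingTime X home ≤ (Nat.find h : ℝ≥0∞) :=
      iInf₂_le (f := fun (t : ℕ) (_ : X t = home) => (t : ℝ≥0∞)) _ (Nat.find_spec h)
    refine hT.trans ?_
    refine le_trans (le_of_eq ?_) (ENNReal.sum_le_tsum (Finset.range (Nat.find h)))
    rw [Finset.sum_congr rfl fun n hn => hone n fun s _ hs =>
      Nat.find_min h (lt_of_le_of_lt hs (Finset.mem_range.1 hn))]
    simp
  · push Not at h
    simp only [fun n => hone n fun s _ _ => h s]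
    rw [ENNReal.tsum_const_eq_top_of_ne_zero one_ne_zero]
    exact le_top

namespace SweepParams

open Filter Topology

variable {P : SweepParams} {home : ℤ × ℤ}

/-- Survival at time n is bounded by survival at the last phase start before n. Eventually that
start is at least n/2, which costs a factor 2^h, and n^(-h) is summable. -/
theorem expectedHittingTime_lt_top (hP : P.p₀ < 1) (hA : 0 < P.A) (hB : 0 < P.B)
    (p : unitInterval) {h C : ℝ} (hh : 1 < h)
    (hC : ∀ᶠ i in atTop,
      P.survFunctional p home i (fun _ => 1) ≤ C * (P.startTime i : ℝ) ^ (-h)) :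
    P.expectedHittingTime p home < ∞ := by
  have hT := P.strictMono_startTime.tendsto_atTop
  obtain ⟨i₀, hi₀⟩ := eventually_atTop.1
    (hC.and (hT.eventually (eventually_duration_le hP hA hB one_pos)))
  set u : ℕ → ℝ≥0∞ := fun n => ∫⁻ q, P.survInd home n q ∂(P.law p) with hu
  have hle : P.expectedHittingTime p home ≤ ∑' n, u n := by
    rw [hu, ← lintegral_tsum fun n => (measurable_survInd n).aemeasurable]
    exact lintegral_mono fun q => hittingTime_le_tsum _ _
  have hu1 : ∀ n, u n ≤ 1 := fun n => by
    calc u n ≤ ∫⁻ _, 1 ∂(P.law p) := lintegral_mono fun q =>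
          ENNReal.ofReal_le_one.2 (notHit_le_one _ _ _)
      _ = 1 := by simp
  have hbound : ∀ n, u (n + P.startTime i₀) ≤
      ENNReal.ofReal (|C| * 2 ^ h * ((n + P.startTime i₀ : ℕ) : ℝ) ^ (-h)) := by
    intro n
    set m := n + P.startTime i₀ with hm
    obtain ⟨i, hi, him, hmi⟩ : ∃ i, i₀ ≤ i ∧ P.startTime i ≤ m ∧ m < P.startTime (i + 1) := by
      have hex : ∃ j, m < P.startTime j := ⟨m + 1, lt_of_lt_of_le (Nat.lt_succ_self m)
        P.strictMono_startTime.le_apply⟩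
      classical
      have hspec := Nat.find_spec hex
      have hpos : i₀ < Nat.find hex := by
        by_contra hcon
        have := P.strictMono_startTime.monotone (not_lt.1 hcon)
        omega
      refine ⟨Nat.find hex - 1, by omega, ?_, ?_⟩
      · exact not_lt.1 (Nat.find_min hex (by omega))
      · rwa [Nat.sub_add_cancel (by omega)]
    obtain ⟨h1, h2⟩ := hi₀ i hi
    have htpos : (0 : ℝ) < P.startTime i := by
      have := P.two_le_startTime i
      exact_mod_cast (by omega : 0 < P.startTime i)
    have h3 : (m : ℝ) ≤ 2 * P.startTime i := by
      have : (m : ℝ) ≤ P.startTime i + P.duration (P.startTime i) := by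
        rw [startTime_succ] at hmi
        exact_mod_cast hmi.le
      linarith
    have hmpos : (0 : ℝ) < m := lt_of_lt_of_le htpos (by exact_mod_cast him)
    calc u m ≤ u (P.startTime i) := lintegral_mono fun q =>
          ENNReal.ofReal_le_ofReal (notHit_antitone _ _ him)
      _ = ENNReal.ofReal (P.survFunctional p home i (fun _ => 1)) := lintegral_survInd hP hB p i
      _ ≤ _ := by
          apply ENNReal.ofReal_le_ofReal
          calc _ ≤ C * (P.startTime i : ℝ) ^ (-h) := h1
            _ ≤ |C| * (P.startTime i : ℝ) ^ (-h) := by gcongr; exact le_abs_self C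
            _ ≤ |C| * ((m : ℝ) / 2) ^ (-h) := by
                refine mul_le_mul_of_nonneg_left ?_ (abs_nonneg C)
                exact Real.rpow_le_rpow_of_nonpos (by positivity) (by linarith) (by linarith)
            _ = _ := by
                rw [Real.div_rpow hmpos.le (by norm_num), Real.rpow_neg (zero_le_two : (0 : ℝ) ≤ 2) h,
                  div_inv_eq_mul]
                ring
  have hsum : Summable fun n : ℕ =>
      |C| * 2 ^ h * ((n + P.startTime i₀ : ℕ) : ℝ) ^ (-h) :=
    ((summable_nat_add_iff (P.startTime i₀)).2
      (Real.summable_nat_rpow.2 (by linarith : -h < -1))).mul_left _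
  refine lt_of_le_of_lt hle ?_
  rw [← ENNReal.summable.sum_add_tsum_nat_add' (k := P.startTime i₀)]
  refine ENNReal.add_lt_top.2 ⟨?_, ?_⟩
  · exact ENNReal.sum_lt_top.2 fun n _ => lt_of_le_of_lt (hu1 n) ENNReal.one_lt_top
  · exact lt_of_le_of_lt (ENNReal.tsum_le_tsum hbound) hsum.tsum_ofReal_lt_top

end SweepParams

/-! ### The main theorem -/

theorem mainTheorem2 :
    ∃ a p₀ : ℝ,
      -- `a = 4.566…` is the maximizer
      (4.566 ≤ a ∧ a < 4.567) ∧
      IsMaxOn (fun b : ℝ => 1 / (2 * b ^ 2) * (1 - 4 * Real.exp (-b ^ 2 / 4 + 2))) (Set.Ioi 0) a ∧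
      -- `p₀ = 0.01139…` is the threshold
      (0.01139 ≤ p₀ ∧ p₀ < 0.01140) ∧
      p₀ * √(3 - 2 * p₀) / (1 - p₀) ^ 2 =
        1 / (2 * a ^ 2) * (1 - 4 * Real.exp (-a ^ 2 / 4 + 2)) ∧
      -- one strategy works for all error probabilities below `p₀` and all homes
      ∀ p : unitInterval, (p : ℝ) < p₀ → ∀ home : ℤ × ℤ,
        SweepParams.expectedHittingTime
          { A := a * √(p₀ / 2 * (3 - 2 * p₀)), B := a * √(p₀ / 2), p₀ := p₀ } p home < ∞ := by
  obtain ⟨a, ha1, ha2, ha⟩ := exists_maximizer_equation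
  have ha0 : 0 < a := by linarith
  obtain ⟨p₀, hp1, hp2, hp⟩ := exists_threshold ha1 ha2
  have heq : p₀ * √(3 - 2 * p₀) / (1 - p₀) ^ 2 =
      1 / (2 * a ^ 2) * (1 - 4 * Real.exp (-a ^ 2 / 4 + 2)) := by
    rw [maximal_value_eq ha0 ha, hp]
  refine ⟨a, p₀, ⟨ha1, ha2⟩, isMaxOn_of_equation ha0 ha, ⟨hp1, hp2⟩, heq, fun p hpp home => ?_⟩
  norm_num at hp1 hp2
  have hp0 : 0 < p₀ := by linarith
  have h3 : 0 < 3 - 2 * p₀ := by linarith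
  have hq : 0 < 1 - p₀ := by linarith
  set P : SweepParams :=
    { A := a * √(p₀ / 2 * (3 - 2 * p₀)), B := a * √(p₀ / 2), p₀ := p₀ } with hPdef
  have hPp : P.p₀ < 1 / 2 := by change p₀ < 1 / 2; linarith
  have hA : 0 < P.A := by change 0 < a * √(p₀ / 2 * (3 - 2 * p₀)); positivity
  have hB : 0 < P.B := by change 0 < a * √(p₀ / 2); positivity
  obtain ⟨h, hh, C, hC⟩ := SweepParams.exists_survFunctional_le (P := P) ha0 p.2.1 hpp hPp rfl rfl
    (by
      -- The left side is 2a² times p₀√(3-2p₀)/(1-p₀)², so the equation for p₀ is exactly the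
      -- balance between killing and growth at h = 1 and b = a.
      change 4 * (a * √(p₀ / 2 * (3 - 2 * p₀)) / (1 - p₀)) * (a * √(p₀ / 2) / (1 - p₀)) = _
      rw [Real.sqrt_mul (by positivity)]
      have hs : √(p₀ / 2) * √(p₀ / 2) = p₀ / 2 := Real.mul_self_sqrt (by positivity)
      calc _ = 4 * a ^ 2 * (√(p₀ / 2) * √(p₀ / 2)) * √(3 - 2 * p₀) / (1 - p₀) ^ 2 := by
            field_simp
        _ = 2 * a ^ 2 * (p₀ * √(3 - 2 * p₀) / (1 - p₀) ^ 2) := by rw [hs]; ring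
        _ = _ := by rw [heq]; field_simp) home
  exact SweepParams.expectedHittingTime_lt_top (by linarith) hA hB p hh hC
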